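/- An arithmetic circuit over $\mathbb{R}$ in $x_1,\dots,x_n$ is a finite directed acyclic graph whose leaves are labelled by variables or real scalars, whose internal nodes are labelled $+$ or $\times$, and which has a designated output node; it computes a polynomial in the usual way. Its size is the number of its nodes (leaves included), and it is monotone if all its scalars are nonnegative. It is layered if its nodes are partitioned into $V_1\cup V_2\cup\dots\cup V_t$ such that $V_1$ consists only of leaves and the children of each internal node in $V_i$ lie in $V_1\cup V_{i-1}$; its width is then $\max_{i>1}|V_i|$. The depth of a circuit is the length of a longest directed path. For $k\in\mathbb{Z}^+$ let $\mathrm{Width}_k$ be the set of families $(f_n)_{n>0}$ of polynomials $f_n\in\mathbb{R}[x_1,\dots,x_n]$ with nonnegative coefficients for which there is a constant $c>0$ such that every $f_n$ is computed by a monotone layered circuit of fan-in two (the two children of a gate may coincide), width at most $k$ and size at most $c\,n^c$. Let $\mathrm{Depth}_k$ be defined in the same way with monotone circuits of unbounded fan-in (without parallel edges), depth at most $k$ and size at most $c\,n^c$. For positive integers $k,\ell$ define $P^\ell_k$ in $\ell^{2k}$ variables by $P^\ell_1(x_1,\dots,x_{\ell^2})=\sum_{i=1}^{\ell}\prod_{j=1}^{\ell}x_{(i-1)\ell+j}$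 and $$P^\ell_{k+1}(x_1,\dots,x_{\ell^{2k+2}})=\sum_{i=1}^{\ell}\prod_{j=1}^{\ell}P^\ell_k\bigl(x_{(i-1)\ell^{2k+1}+(j-1)\ell^{2k}+1},\dots,x_{(i-1)\ell^{2k+1}+j\ell^{2k}}\bigr).$$ Theorem. For every $k\in\mathbb{Z}^+$, $$\mathrm{Width}_k\subsetneq\mathrm{Width}_{2k}\quad\text{and}\quad \mathrm{Depth}_k\subsetneq\mathrm{Depth}_{2k}.$$ Moreover, the family $\bigl(P_k^{\lfloor n^{1/2k}\rfloor}\bigr)_{n>0}$ lies in $\mathrm{Width}_{2k}\setminus\mathrm{Width}_k$ and in $\mathrm{Depth}_{2k}\setminus\mathrm{Depth}_k$. -/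

import Mathlib

namespace MonotoneCircuit

open MvPolynomial

/-- A node of an arithmetic circuit in the variables `x_0, …, x_{n-1}` whose nodes are numbered
by `Fin s`: a leaf (a variable or a real scalar), or a plus / multiply gate together with
the multiset of its children (a multiset, since both wires of a gate may come from one node). -/
inductive Node (n s : ℕ) : Type
  | var (i : Fin n) : Node n s
  | const (c : ℝ) : Node n s
  | add (ch : Multiset (Fin s)) : Node n s
  | mul (ch : Multiset (Fin s)) : Node n s

/-- The children of a node. -/
def Node.children {n s : ℕ} : Node n s → Multiset (Fin s)
  | .var _ => 0
  | .const _ => 0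
  | .add ch => ch
  | .mul ch => ch

/-- Leaves are the nodes labelled by a variable or a scalar. -/
def Node.IsLeaf {n s : ℕ} : Node n s → Prop
  | .var _ => True
  | .const _ => True
  | .add _ => False
  | .mul _ => False

/-- An arithmetic circuit over `ℝ` in `n` variables: a finite directed acyclic graph, its nodes
listed in a topological order, with a designated output node. `size` is the number of all nodes,
leaves included. -/
structure Circuit (n : ℕ) where
  size : ℕ
  node : Fin size → Node n size
  child_lt : ∀ v, ∀ u ∈ (node v).children, u < v
  children_ne : ∀ v, ¬ (node v).IsLeaf → (node v).children ≠ 0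
  output : Fin size

namespace Circuit

variable {n : ℕ}

/-- The polynomial computed at a node. -/
noncomputable def polyAt (C : Circuit n) (v : Fin C.size) : MvPolynomial (Fin n) ℝ :=
  match h : C.node v with
  | .var i => X i
  | .const c => MvPolynomial.C c
  | .add ch =>
      (ch.attach.map fun (u : {x // x ∈ ch}) =>
        have : u.1 < v := C.child_lt v u.1 (by rw [h]; exact u.2)
        C.polyAt u.1).sum
  | .mul ch =>
      (ch.attach.map fun (u : {x // x ∈ ch}) =>
        have : u.1 < v := C.child_lt v u.1 (by rw [h]; exact u.2)
        C.polyAt u.1).prod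
termination_by v

/-- The polynomial computed by the circuit. -/
noncomputable def poly (C : Circuit n) : MvPolynomial (Fin n) ℝ := C.polyAt C.output

/-- The depth of a node: the largest number of wires on a path from a leaf to it. -/
def depthAt (C : Circuit n) (v : Fin C.size) : ℕ :=
  match h : C.node v with
  | .var _ => 0
  | .const _ => 0
  | .add ch =>
      1 + (ch.attach.map fun (u : {x // x ∈ ch}) =>
        have : u.1 < v := C.child_lt v u.1 (by rw [h]; exact u.2)
        C.depthAt u.1).sup
  | .mul ch =>
      1 + (ch.attach.map fun (u : {x // x ∈ ch}) =>
        have : u.1 < v := C.child_lt v u.1 (by rw [h]; exact u.2)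
        C.depthAt u.1).sup
termination_by v

/-- The depth of a circuit: the length of a longest directed path. -/
def depth (C : Circuit n) : ℕ := Finset.univ.sup C.depthAt

/-- A circuit is monotone if all its scalars are nonnegative. -/
def Monotone (C : Circuit n) : Prop := ∀ v c, C.node v = .const c → 0 ≤ c

/-- Every internal node has indegree two; the two children may coincide. -/
def FanInTwo (C : Circuit n) : Prop := ∀ v, ¬ (C.node v).IsLeaf → (C.node v).children.card = 2

/-- No two wires join the same pair of nodes. Used for circuits of unbounded fan-in, where it makes
the fan-in at most the number of nodes. -/
def NoParallelWires (C : Circuit n) : Prop := ∀ v, (C.node v).children.Nodup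

/-- A partition of the nodes into layers `V_1, V_2, …`, where `V_1` consists only of leaves and
every child of an internal node of `V_i` lies in `V_1` or in `V_{i-1}`. -/
structure Layering (C : Circuit n) where
  layer : Fin C.size → ℕ
  one_le : ∀ v, 1 ≤ layer v
  leaf_of_one : ∀ v, layer v = 1 → (C.node v).IsLeaf
  child : ∀ v, ∀ u ∈ (C.node v).children, layer u = 1 ∨ layer u + 1 = layer v

/-- The width `max_{i > 1} |V_i|` of a layered circuit; the first layer is not counted. -/
def Layering.width {C : Circuit n} (L : C.Layering) : ℕ :=
  ((Finset.univ.image L.layer).filter (1 < ·)).sup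
    fun i => (Finset.univ.filter fun v => L.layer v = i).card

end Circuit

/-- A real polynomial is monotone if all its coefficients are nonnegative. -/
def MonotonePoly {n : ℕ} (f : MvPolynomial (Fin n) ℝ) : Prop := ∀ m, 0 ≤ f.coeff m

/-- Families `(f_n)_{n > 0}` with `f_n ∈ ℝ[x_1, …, x_n]`. -/
abbrev Family : Type := (n : ℕ+) → MvPolynomial (Fin n) ℝ

/-- Families of monotone polynomials computed by monotone layered circuits with fan-in two, of width
at most `k` and size at most `c * n ^ c`. -/
def WidthClassWith (k c : ℕ) : Set Family :=
  {f | ∀ n : ℕ+, MonotonePoly (f n) ∧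
    ∃ (C : Circuit n) (L : C.Layering), C.Monotone ∧ C.FanInTwo ∧ L.width ≤ k ∧
      C.size ≤ c * (n : ℕ) ^ c ∧ C.poly = f n}

/-- Families of monotone polynomials computed by monotone circuits with unbounded fan-in, of depth
at most `k` and size at most `c * n ^ c`. -/
def DepthClassWith (k c : ℕ) : Set Family :=
  {f | ∀ n : ℕ+, MonotonePoly (f n) ∧
    ∃ C : Circuit n, C.Monotone ∧ C.NoParallelWires ∧ C.depth ≤ k ∧
      C.size ≤ c * (n : ℕ) ^ c ∧ C.poly = f n}

/-- `Width_k`. -/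
def WidthClass (k : ℕ) : Set Family := ⋃ c : ℕ, ⋃ _ : 0 < c, WidthClassWith k c

/-- `Depth_k`. -/
def DepthClass (k : ℕ) : Set Family := ⋃ c : ℕ, ⋃ _ : 0 < c, DepthClassWith k c

theorem index_lt (l k : ℕ) (i j : Fin l) (a : Fin (l ^ (2 * k))) :
    (i : ℕ) * l ^ (2 * k + 1) + (j : ℕ) * l ^ (2 * k) + (a : ℕ) < l ^ (2 * (k + 1)) := by
  have hi : (i : ℕ) + 1 ≤ l := i.2
  have hj : (j : ℕ) + 1 ≤ l := j.2
  have ha : (a : ℕ) < l ^ (2 * k) := a.2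
  have h1 := Nat.mul_le_mul_right (l ^ (2 * k)) hj
  have h2 := Nat.mul_le_mul_right (l ^ (2 * k + 1)) hi
  have e1 : l ^ (2 * k + 1) = l * l ^ (2 * k) := by ring
  have e2 : l ^ (2 * (k + 1)) = l * l ^ (2 * k + 1) := by ring
  rw [e2]
  nlinarith

/-- The polynomial `P^l_k` on `l ^ (2k)` variables (numbered from `0`):
`P^l_{k+1} = ∑_{i<l} ∏_{j<l} P^l_k`, the `(i, j)` copy on its own block of `l ^ (2k)` consecutive
variables. The recursion starts at a single variable, so that `P^l_1 = ∑_{i<l} ∏_{j<l} x_{i l + j}`. -/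
noncomputable def hardPoly (l : ℕ) : (k : ℕ) → MvPolynomial (Fin (l ^ (2 * k))) ℝ
  | 0 => X ⟨0, by simp⟩
  | k + 1 => ∑ i : Fin l, ∏ j : Fin l,
      rename (fun a : Fin (l ^ (2 * k)) =>
        (⟨(i : ℕ) * l ^ (2 * k + 1) + (j : ℕ) * l ^ (2 * k) + (a : ℕ), index_lt l k i j a⟩ :
          Fin (l ^ (2 * (k + 1))))) (hardPoly l k)

/-- `⌊n^{1/2k}⌋`. -/
noncomputable def floorRoot (k n : ℕ) : ℕ := ⌊(n : ℝ) ^ (1 / (2 * (k : ℝ)))⌋₊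

theorem floorRoot_pow_le (k : ℕ) (n : ℕ+) : floorRoot k n ^ (2 * k) ≤ (n : ℕ) := by
  rcases Nat.eq_zero_or_pos k with rfl | hk
  · simp [floorRoot, Nat.one_le_iff_ne_zero]
  · have h0 : (0 : ℝ) ≤ ((n : ℕ) : ℝ) := Nat.cast_nonneg _
    have h1 : (floorRoot k n : ℝ) ≤ ((n : ℕ) : ℝ) ^ (1 / (2 * (k : ℝ))) :=
      Nat.floor_le (Real.rpow_nonneg h0 _)
    have h2 : (floorRoot k n : ℝ) ^ (2 * k) ≤ (((n : ℕ) : ℝ) ^ (1 / (2 * (k : ℝ)))) ^ (2 * k) :=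
      pow_le_pow_left₀ (Nat.cast_nonneg _) h1 _
    have h3 : (((n : ℕ) : ℝ) ^ (1 / (2 * (k : ℝ)))) ^ (2 * k) = ((n : ℕ) : ℝ) := by
      have := Real.rpow_inv_natCast_pow h0 (n := 2 * k) (by omega)
      simpa [one_div] using this
    rw [h3] at h2
    exact_mod_cast h2

/-- The family `n ↦ P^l_k` with `l = ⌊n^{1/2k}⌋`, as a polynomial in `x_1, …, x_n`. -/
noncomputable def hardFamily (k : ℕ) : Family := fun n =>
  rename (Fin.castLE (floorRoot_pow_le k n)) (hardPoly (floorRoot k n) k)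

end MonotoneCircuit

namespace MonotoneCircuit

open MvPolynomial

/-! ### Set systems: the supports of the monomials of a polynomial -/

/-! Monotone polynomials have no cancellation, so the set `supp f` of the variable sets of the
monomials of `f` turns sums into unions and products into pairwise unions (`supp_add`, `supp_mul`).
A monotone circuit therefore computes set systems, and the lower bounds are proved for set systems
alone; leaves may then be arbitrary systems of sets with at most one element.

The lower bounds are inductions on `k` for any dense part of the system of `P^l_k`, that is, one
containing more than half of the monomials. Every monomial of `P^l_k` lies in one of the `l` blocks
belonging to the terms of the outer sum. If a product of two systems consists of such monomials and
neither factor is constant, then the whole product lies in one block (`joins_block`). Tracing a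
monomial `m` back from the output through gates whose contents consist of monomials of `P^l_k`, one
must therefore reach a gate that contains `m` and whose contents lie in a single block. In depth `k
+ 1` this gate has depth at most `k` (`DepthComp.cover`).

For width (`WidthComp.cover`), let `m₀` be a monomial whose trace reaches such a single-block gate
at the earliest time `u`. From time `u` on, some register of each layer up to the end contains `m₀`.
At most `k + 1` blocks are met by registers that at time `u` can still contribute to a single-block
gate. For any other block `i`, the gate found for a monomial of block `i` comes later than `u`; its
value depends neither on the registers containing `m₀`, which lies in another block, nor on the
nonconstant contents at time `u`. Restarting at time `u` without these registers computes the same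
gate with one register fewer.

Thus a dense system is covered, outside few blocks, by few single-block systems computed with one
resource unit less. By counting, one of them has a dense trace on one of the `l` factors of its
block (`Dense.exists_restrict`): traces of density at most 1/2 on all `l` factors would bound its
density inside the block by `2 ^ (-l)`, too little for a cover by fewer than `2 ^ l / 4` systems.
That factor is a copy of `P^l_{k-1}`, and the induction continues. It ends at width or depth zero,
where only sets with at most two, respectively one, elements arise. Since `l` is a fixed power of
`n`, polynomial size stays below `2 ^ l / 4` for large `l`.

For the upper bounds, the defining formula has depth `2k`, and its sequential evaluation keeps one
sum accumulator and one product accumulator for each of the `k` levels. -/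

/-- The pairwise unions of members of two set systems. -/
def joins {σ : Type} (A B : Set (Set σ)) : Set (Set σ) := Set.image2 (· ∪ ·) A B

/-- All members have at most one element. -/
def IsLeafSet {σ : Type} (A : Set (Set σ)) : Prop := ∀ m ∈ A, m.Subsingleton

/-- All elements of `m` lie in the block `i`. -/
def InBlock {σ ι : Type} (blk : σ → ι) (i : ι) (m : Set σ) : Prop := ∀ x ∈ m, blk x = i

theorem InBlock.eq {σ ι : Type} {blk : σ → ι} {i i' : ι} {m : Set σ} (h : InBlock blk i m)
    (h' : InBlock blk i' m) (hm : m.Nonempty) : i = i' := by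
  obtain ⟨x, hx⟩ := hm
  rw [← h x hx, h' x hx]

theorem InBlock.union {σ ι : Type} {blk : σ → ι} {i : ι} {m m' : Set σ} (h : InBlock blk i m)
    (h' : InBlock blk i m') : InBlock blk i (m ∪ m') := by
  rintro x (hx | hx)
  exacts [h x hx, h' x hx]

theorem InBlock.mono {σ ι : Type} {blk : σ → ι} {i : ι} {m m' : Set σ} (h : InBlock blk i m)
    (h' : m' ⊆ m) : InBlock blk i m' := fun x hx => h x (h' hx)

theorem joins_mono {σ : Type} {A A' B B' : Set (Set σ)} (hA : A ⊆ A') (hB : B ⊆ B') :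
    joins A B ⊆ joins A' B' := Set.image2_subset hA hB

theorem joins_comm {σ : Type} (A B : Set (Set σ)) : joins A B = joins B A :=
  Set.image2_comm fun a b => Set.union_comm a b

theorem joins_singleton_empty {σ : Type} (A : Set (Set σ)) : joins A {∅} = A := by
  simp [joins]

theorem eq_singleton_empty {σ : Type} {A : Set (Set σ)} (hA : A.Nonempty)
    (h : ∀ m ∈ A, ¬ m.Nonempty) : A = {∅} := by
  rw [Set.eq_singleton_iff_nonempty_unique_mem]
  exact ⟨hA, fun m hm => Set.not_nonempty_iff_eq_empty.1 (h m hm)⟩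

/-- A nontrivial product inside a union of blocks lies in one block. -/
theorem joins_block {σ ι : Type} {blk : σ → ι} {A B : Set (Set σ)}
    (hAB : ∀ m ∈ joins A B, ∃ i, InBlock blk i m) (hA : A.Nonempty) (hB : B.Nonempty) :
    A = {∅} ∨ B = {∅} ∨ ∃ i, ∀ m ∈ joins A B, InBlock blk i m := by
  by_cases h1 : ∀ m ∈ A, ¬ m.Nonempty
  · exact Or.inl (eq_singleton_empty hA h1)
  by_cases h2 : ∀ m ∈ B, ¬ m.Nonempty
  · exact Or.inr (Or.inl (eq_singleton_empty hB h2))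
  push Not at h1 h2
  obtain ⟨p, hp, hpn⟩ := h1
  obtain ⟨q, hq, hqn⟩ := h2
  refine Or.inr (Or.inr ?_)
  -- The nonempty sets `p` and `q` share the block `i`. Any other left factor is tied to `i` through
  -- `q`, any other right factor through `p`.
  obtain ⟨i, hi⟩ := hAB _ (Set.mem_image2_of_mem hp hq)
  have hpi : InBlock blk i p := hi.mono Set.subset_union_left
  have hqi : InBlock blk i q := hi.mono Set.subset_union_right
  refine ⟨i, ?_⟩
  rintro _ ⟨p', hp', q', hq', rfl⟩
  refine InBlock.union ?_ ?_
  · obtain ⟨i', hi'⟩ := hAB _ (Set.mem_image2_of_mem hp' hq)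
    have : i = i' := hqi.eq (hi'.mono Set.subset_union_right) hqn
    subst this
    exact hi'.mono Set.subset_union_left
  · obtain ⟨i', hi'⟩ := hAB _ (Set.mem_image2_of_mem hp hq')
    have : i = i' := hpi.eq (hi'.mono Set.subset_union_left) hpn
    subst this
    exact hi'.mono Set.subset_union_right

/-- Restriction of the members of a set system along a map of the ground sets. -/
def restrict {σ τ : Type} (ψ : τ → σ) (A : Set (Set σ)) : Set (Set τ) := (ψ ⁻¹' ·) '' A

theorem restrict_union {σ τ : Type} (ψ : τ → σ) (A B : Set (Set σ)) :
    restrict ψ (A ∪ B) = restrict ψ A ∪ restrict ψ B := Set.image_union ..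

theorem restrict_joins {σ τ : Type} (ψ : τ → σ) (A B : Set (Set σ)) :
    restrict ψ (joins A B) = joins (restrict ψ A) (restrict ψ B) :=
  Set.image_image2_distrib fun _ _ => Set.preimage_union

theorem IsLeafSet.restrict {σ τ : Type} {ψ : τ → σ} (hψ : Function.Injective ψ)
    {A : Set (Set σ)} (hA : IsLeafSet A) : IsLeafSet (restrict ψ A) := by
  rintro _ ⟨m, hm, rfl⟩
  exact (hA m hm).preimage hψ

/-! ### Layered computations of set systems -/

/-- An operand of a gate: a register of the previous layer or a leaf. -/
inductive Operand (κ σ : Type) : Type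
  | reg (r : κ) : Operand κ σ
  | leaf (A : Set (Set σ)) (h : IsLeafSet A) : Operand κ σ

/-- A gate of fan-in two. -/
inductive Gate (κ σ : Type) : Type
  | add (x y : Operand κ σ) : Gate κ σ
  | mul (x y : Operand κ σ) : Gate κ σ

variable {κ σ τ ι : Type}

def Operand.eval (G : κ → Set (Set σ)) : Operand κ σ → Set (Set σ)
  | .reg r => G r
  | .leaf A _ => A

def Gate.eval (G : κ → Set (Set σ)) : Gate κ σ → Set (Set σ)
  | .add x y => x.eval G ∪ y.eval G
  | .mul x y => joins (x.eval G) (y.eval G)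

theorem isLeafSet_empty : IsLeafSet (∅ : Set (Set σ)) := fun _ h => h.elim

/-- The gate computing the leaf `A`. -/
def Gate.ofLeaf (A : Set (Set σ)) (h : IsLeafSet A) : Gate κ σ := .add (.leaf A h) (.leaf A h)

@[simp] theorem Gate.eval_ofLeaf (G : κ → Set (Set σ)) (A : Set (Set σ)) (h : IsLeafSet A) :
    (Gate.ofLeaf A h : Gate κ σ).eval G = A := Set.union_self A

theorem Operand.eval_mono {G G' : κ → Set (Set σ)} (h : ∀ r, G r ⊆ G' r) (x : Operand κ σ) :
    x.eval G ⊆ x.eval G' := by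
  cases x
  exacts [h _, subset_rfl]

theorem Gate.eval_mono {G G' : κ → Set (Set σ)} (h : ∀ r, G r ⊆ G' r) (o : Gate κ σ) :
    o.eval G ⊆ o.eval G' := by
  cases o with
  | add x y => exact Set.union_subset_union (x.eval_mono h) (y.eval_mono h)
  | mul x y => exact joins_mono (x.eval_mono h) (y.eval_mono h)

/-- If `G'` agrees with `G` on the registers which can be completed to members of `R`, then it
agrees on the gates with this property. -/
theorem Operand.eval_subset_of_completable {G G' : κ → Set (Set σ)} {R : Set σ → Prop}
    (hG : ∀ r h, (∀ p ∈ G r, R (h ∪ p)) → G r ⊆ G' r) (x : Operand κ σ) (h : Set σ)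
    (hx : ∀ p ∈ x.eval G, R (h ∪ p)) : x.eval G ⊆ x.eval G' := by
  cases x
  exacts [hG _ h hx, subset_rfl]

theorem Gate.eval_subset_of_completable {G G' : κ → Set (Set σ)} {R : Set σ → Prop}
    (hG : ∀ r h, (∀ p ∈ G r, R (h ∪ p)) → G r ⊆ G' r) (o : Gate κ σ) (h : Set σ)
    (ho : ∀ p ∈ o.eval G, R (h ∪ p)) : o.eval G ⊆ o.eval G' := by
  cases o with
  | add x y =>
    exact Set.union_subset_union
      (x.eval_subset_of_completable hG h fun p hp => ho p (Or.inl hp))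
      (y.eval_subset_of_completable hG h fun p hp => ho p (Or.inr hp))
  | mul x y =>
    rintro _ ⟨p, hp, q, hq, rfl⟩
    refine Set.mem_image2_of_mem ?_ ?_
    -- A member `q` of the other factor is absorbed into the completing set, so completability
    -- passes from the product to its factor.
    · refine x.eval_subset_of_completable hG (h ∪ q) (fun p' hp' => ?_) hp
      have := ho _ (Set.mem_image2_of_mem hp' hq)
      rwa [Set.union_comm p' q, ← Set.union_assoc] at this
    · refine y.eval_subset_of_completable hG (h ∪ p) (fun q' hq' => ?_) hq
      have := ho _ (Set.mem_image2_of_mem hp hq')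
      rwa [← Set.union_assoc] at this

/-- A member of a gate computing a subset of `S` comes from an operand computing a subset of `S`,
unless the gate computes a subset of a single block. -/
theorem Gate.descend {blk : σ → ι} {S : Set (Set σ)} (hS1 : ∀ m ∈ S, m.Nontrivial)
    (hS2 : ∀ m ∈ S, ∃ i, InBlock blk i m) {G : κ → Set (Set σ)} {o : Gate κ σ}
    (ho : o.eval G ⊆ S) {m : Set σ} (hm : m ∈ o.eval G) :
    (∃ r, m ∈ G r ∧ G r ⊆ S) ∨ ∃ i, ∀ m' ∈ o.eval G, InBlock blk i m' := by
  have key : ∀ x : Operand κ σ, x.eval G ⊆ S → m ∈ x.eval G → ∃ r, m ∈ G r ∧ G r ⊆ S := by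
    rintro (r | ⟨A, hA⟩) hxS hmx
    · exact ⟨r, hmx, hxS⟩
    · exact absurd (hA m hmx) (Set.not_subsingleton_iff.2 (hS1 m (hxS hmx)))
  cases o with
  | add x y =>
    left
    rcases hm with hm | hm
    · exact key x (Set.subset_union_left.trans ho) hm
    · exact key y (Set.subset_union_right.trans ho) hm
  | mul x y =>
    have hne := hm
    obtain ⟨p, hp, q, hq, -⟩ := hne
    rcases joins_block (fun m' hm' => hS2 m' (ho hm')) ⟨p, hp⟩ ⟨q, hq⟩ with h | h | h
    · left
      have e : (Gate.mul x y).eval G = y.eval G := by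
        simp only [Gate.eval, h]
        rw [joins_comm, joins_singleton_empty]
      rw [e] at ho hm
      exact key y ho hm
    · left
      have e : (Gate.mul x y).eval G = x.eval G := by
        simp only [Gate.eval, h, joins_singleton_empty]
      rw [e] at ho hm
      exact key x ho hm
    · exact Or.inr h

def Operand.restrict {ψ : τ → σ} (hψ : Function.Injective ψ) : Operand κ σ → Operand κ τ
  | .reg r => .reg r
  | .leaf A h => .leaf (MonotoneCircuit.restrict ψ A) (h.restrict hψ)

def Gate.restrict {ψ : τ → σ} (hψ : Function.Injective ψ) : Gate κ σ → Gate κ τ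
  | .add x y => .add (x.restrict hψ) (y.restrict hψ)
  | .mul x y => .mul (x.restrict hψ) (y.restrict hψ)

theorem Operand.eval_restrict {ψ : τ → σ} (hψ : Function.Injective ψ) (G : κ → Set (Set σ))
    (x : Operand κ σ) :
    (x.restrict hψ).eval (fun r => MonotoneCircuit.restrict ψ (G r)) =
      MonotoneCircuit.restrict ψ (x.eval G) := by
  cases x <;> rfl

theorem Gate.eval_restrict {ψ : τ → σ} (hψ : Function.Injective ψ) (G : κ → Set (Set σ))
    (o : Gate κ σ) :
    (o.restrict hψ).eval (fun r => MonotoneCircuit.restrict ψ (G r)) =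
      MonotoneCircuit.restrict ψ (o.eval G) := by
  cases o <;>
    simp only [Gate.restrict, Gate.eval, Operand.eval_restrict, restrict_union, restrict_joins]

/-- A layered computation: the contents `val t r` of the register `r` at time `t`, and the gates
computing them from the previous layer. Every register is nonempty at one time only. The
registers before `T` and a last gate `out` give the result. -/
structure LayeredComp (κ σ : Type) where
  val : ℕ → κ → Set (Set σ)
  gate : ℕ → κ → Gate κ σ
  time : κ → ℕ
  length : ℕ
  out : Gate κ σ
  val_zero : ∀ r, val 0 r ⊆ {∅}
  val_succ : ∀ t r, val (t + 1) r = (gate t r).eval (val t)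
  eq_time : ∀ t r, (val t r).Nonempty → t = time r

/-- `A` is computed by a layered computation with at most `s` registers, at most `k` of them
nonempty at any time. -/
def WidthComp (k s : ℕ) (A : Set (Set σ)) : Prop :=
  ∃ (κ : Type) (_ : Fintype κ) (P : LayeredComp κ σ), Fintype.card κ ≤ s ∧
    (∀ t ≤ P.length, {r | (P.val t r).Nonempty}.ncard ≤ k) ∧ A = P.out.eval (P.val P.length)

/-- Preimages commute with both gates and do not change which registers are nonempty, so neither
size nor width grows. -/
theorem WidthComp.restrict {k s : ℕ} {A : Set (Set σ)} (h : WidthComp k s A) {ψ : τ → σ}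
    (hψ : Function.Injective ψ) : WidthComp k s (restrict ψ A) := by
  obtain ⟨κ, hκ, P, hs, hk, rfl⟩ := h
  refine ⟨κ, hκ,
    { val := fun t r => MonotoneCircuit.restrict ψ (P.val t r)
      gate := fun t r => (P.gate t r).restrict hψ
      time := P.time
      length := P.length
      out := P.out.restrict hψ
      val_zero := ?_
      val_succ := ?_
      eq_time := ?_ }, hs, ?_, ?_⟩
  · rintro r _ ⟨m, hm, rfl⟩
    have : m = ∅ := P.val_zero r hm
    simp [this]
  · intro t r
    rw [P.val_succ, Gate.eval_restrict]
  · intro t r hr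
    exact P.eq_time t r (Set.image_nonempty.1 hr)
  · intro t ht
    simpa only [MonotoneCircuit.restrict, Set.image_nonempty] using hk t ht
  · exact (Gate.eval_restrict hψ _ _).symm

/-- With no registers only unions of two leaves can be computed. -/
theorem WidthComp.eq_union {s : ℕ} {A : Set (Set σ)} (h : WidthComp 0 s A) {m : Set σ}
    (hm : m ∈ A) : ∃ p q : Set σ, p.Subsingleton ∧ q.Subsingleton ∧ m = p ∪ q := by
  obtain ⟨κ, hκ, P, -, hk, rfl⟩ := h
  have h0 : ∀ r, ¬ (P.val P.length r).Nonempty := by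
    intro r hr
    have h1 := hk P.length le_rfl
    rw [Nat.le_zero, Set.ncard_eq_zero] at h1
    exact (h1 ▸ hr : r ∈ (∅ : Set κ))
  have key : ∀ x : Operand κ σ, ∀ p ∈ x.eval (P.val P.length), p.Subsingleton := by
    rintro (r | ⟨A, hA⟩) p hp
    · exact (h0 r ⟨p, hp⟩).elim
    · exact hA p hp
  revert hm
  cases P.out with
  | add x y =>
    rintro (hm | hm)
    · exact ⟨m, ∅, key _ m hm, Set.subsingleton_empty, by simp⟩
    · exact ⟨m, ∅, key _ m hm, Set.subsingleton_empty, by simp⟩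
  | mul x y =>
    rintro ⟨p, hp, q, hq, rfl⟩
    exact ⟨p, q, key _ p hp, key _ q hq, rfl⟩

/-! ### Restarting a layered computation, and the covering lemma for width -/

open Classical in
/-- The values after a restart at time `u` which keeps only constant terms and removes the
registers containing `m`. -/
noncomputable def LayeredComp.restartVal (P : LayeredComp κ σ) (u : ℕ) (m : Set σ) :
    ℕ → κ → Set (Set σ)
  | 0 => fun r => if m ∈ P.val u r then ∅ else P.val u r ∩ {∅}
  | t + 1 => fun r => if m ∈ P.val (u + t + 1) r then ∅ else
      (P.gate (u + t) r).eval (P.restartVal u m t)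

theorem LayeredComp.restartVal_subset (P : LayeredComp κ σ) (u : ℕ) (m : Set σ) (t : ℕ) (r : κ) :
    P.restartVal u m t r ⊆ P.val (u + t) r := by
  induction t generalizing r with
  | zero =>
    simp only [restartVal]
    split_ifs
    exacts [Set.empty_subset _, Set.inter_subset_left]
  | succ t ih =>
    simp only [restartVal]
    split_ifs
    · exact Set.empty_subset _
    · rw [← add_assoc, P.val_succ]
      exact Gate.eval_mono ih _

theorem LayeredComp.not_mem_of_restartVal_nonempty (P : LayeredComp κ σ) (u : ℕ) (m : Set σ)
    (t : ℕ) (r : κ) (h : (P.restartVal u m t r).Nonempty) : m ∉ P.val (u + t) r := by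
  intro hm
  cases t with
  | zero =>
    simp only [add_zero] at hm
    simp [restartVal, hm] at h
  | succ t =>
    rw [← add_assoc] at hm
    simp [restartVal, hm] at h

/-- A register whose whole content can be completed to `R` by one set cannot contain `m`, so it is
not deleted; at time `u` such a register is already constant, so it is not truncated. Completability
is inherited by the operands that matter, hence the restart loses nothing there. -/
theorem LayeredComp.subset_restartVal (P : LayeredComp κ σ) (u : ℕ) (m : Set σ)
    {R : Set σ → Prop} (hm : ∀ h, ¬ R (h ∪ m))
    (hu : ∀ r h, (∀ p ∈ P.val u r, R (h ∪ p)) → P.val u r ⊆ {∅}) (t : ℕ) (r : κ) (h : Set σ)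
    (hr : ∀ p ∈ P.val (u + t) r, R (h ∪ p)) : P.val (u + t) r ⊆ P.restartVal u m t r := by
  induction t generalizing r h with
  | zero =>
    have : m ∉ P.val u r := fun hmr => hm h (hr m hmr)
    simp only [restartVal, if_neg this, add_zero]
    exact Set.subset_inter subset_rfl (hu r h hr)
  | succ t ih =>
    rw [← add_assoc] at hr ⊢
    have : m ∉ P.val (u + t + 1) r := fun hmr => hm h (hr m hmr)
    simp only [restartVal, if_neg this]
    rw [P.val_succ] at hr ⊢
    exact Gate.eval_subset_of_completable ih _ h hr

open Classical in
/-- The computation up to register `r` at time `u + t + 1`, restarted at time `u`. -/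
noncomputable def LayeredComp.restart (P : LayeredComp κ σ) (u : ℕ) (m : Set σ) (t : ℕ) (r : κ) :
    LayeredComp κ σ where
  val := P.restartVal u m
  gate t r := if m ∈ P.val (u + t + 1) r then Gate.ofLeaf ∅ isLeafSet_empty else P.gate (u + t) r
  time r := P.time r - u
  length := t
  out := P.gate (u + t) r
  val_zero r := by
    simp only [restartVal]
    split_ifs
    exacts [Set.empty_subset _, Set.inter_subset_right]
  val_succ t r := by
    simp only [restartVal]
    split_ifs
    · simp
    · rfl
  eq_time t r h := by
    have := P.eq_time _ _ (h.mono (P.restartVal_subset u m t r))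
    omega

/-- A set system inside `S` computed with `k + 1` registers is covered, up to `k + 1` blocks, by
set systems inside single blocks which are computed with `k` registers. -/
theorem WidthComp.cover [DecidableEq ι] {blk : σ → ι} {S : Set (Set σ)}
    (hS1 : ∀ m ∈ S, m.Nontrivial) (hS2 : ∀ m ∈ S, ∃ i, InBlock blk i m) {k s : ℕ}
    {A : Set (Set σ)} (hA : WidthComp (k + 1) s A) (hAS : A ⊆ S)
    (hblk : ¬ ∃ i, ∀ m ∈ A, InBlock blk i m) :
    ∃ (bad : Finset ι) (κ : Type) (_ : Fintype κ) (H : κ → Set (Set σ)), bad.card ≤ k + 1 ∧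
      Fintype.card κ ≤ s ∧ ∀ i ∉ bad, ∀ m ∈ A, InBlock blk i m → ∃ r, m ∈ H r ∧
        (∀ m' ∈ H r, m' ∈ S ∧ InBlock blk i m') ∧ WidthComp k s (H r) := by
  classical
  obtain ⟨κ, hκ, P, hs, hk, rfl⟩ := hA
  set g := P.val with hg
  set T := P.length with hT
  set A := P.out.eval (g T) with hAdef
  -- `Good t m` asks for a single-block register at time `t` and for the presence of `m` at all
  -- times from `t` to `T`. The second condition supplies a register to delete in every layer.
  let Pr : ℕ → Set σ → Prop := fun t m => ∃ r, m ∈ g t r ∧ g t r ⊆ S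
  let Good : ℕ → Set σ → Prop := fun t m => t ≤ T ∧ (∀ t', t ≤ t' → t' ≤ T → Pr t' m) ∧
    ∃ r i, m ∈ g t r ∧ g t r ⊆ S ∧ ∀ m' ∈ g t r, InBlock blk i m'
  have hgood : ∀ m ∈ A, ∃ t, Good t m := by
    intro m hm
    have hPT : Pr T m := by
      rcases Gate.descend hS1 hS2 hAS hm with h | h
      exacts [h, (hblk h).elim]
    have hex : ∃ t, t ≤ T ∧ ∀ t', t ≤ t' → t' ≤ T → Pr t' m := by
      refine ⟨T, le_rfl, fun t' h1 h2 => ?_⟩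
      rwa [le_antisymm h2 h1]
    obtain ⟨h1, h2⟩ := Nat.find_spec hex
    -- The trace of `m` is followed back to its earliest time. There `Gate.descend` cannot go
    -- further down, so the gate lies in a single block.
    have h3 := fun t => Nat.find_min hex (m := t)
    generalize Nat.find hex = t at h1 h2 h3
    refine ⟨t, h1, h2, ?_⟩
    obtain ⟨r, hmr, hrS⟩ := h2 t le_rfl h1
    cases t with
    | zero =>
      have : m = ∅ := P.val_zero r hmr
      have := hS1 m (hrS hmr)
      simp_all
    | succ t =>
      have h4 : ¬ Pr t m := by
        intro h4
        refine h3 t (Nat.lt_succ_self t) ⟨by omega, fun t' ht1 ht2 => ?_⟩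
        rcases eq_or_lt_of_le ht1 with rfl | ht1
        exacts [h4, h2 t' ht1 ht2]
      have e := P.val_succ t r
      rw [← hg] at e
      rcases Gate.descend hS1 hS2 (e ▸ hrS) (e ▸ hmr) with h | ⟨i, hi⟩
      · exact (h4 h).elim
      · exact ⟨r, i, hmr, hrS, e ▸ hi⟩
  by_cases hne : A.Nonempty
  swap
  · refine ⟨∅, κ, hκ, fun _ => ∅, by simp, hs, fun i _ m hm => (hne ⟨m, hm⟩).elim⟩
  have hex : ∃ t, ∃ m ∈ A, Good t m := by
    obtain ⟨m, hm⟩ := hne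
    obtain ⟨t, ht⟩ := hgood m hm
    exact ⟨t, m, hm, ht⟩
  obtain ⟨m₀, hm₀, huT, hpath, r₀, i₀, hr₀, hr₀S, hr₀i⟩ := Nat.find_spec hex
  have hmin : ∀ m ∈ A, ∀ t, Good t m → Nat.find hex ≤ t := fun m hm t ht =>
    Nat.find_min' hex ⟨m, hm, ht⟩
  generalize Nat.find hex = u at *
  have hm₀n : m₀.Nonempty := (hS1 _ (hAS hm₀)).nonempty
  -- The block of some variable occurring in the register at time `u`; it is the only possible block
  -- if the register can be completed inside one block. The default `i₀` serves registers without
  -- variables.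
  let f : κ → ι := fun r => if h : ∃ x, ∃ p ∈ g u r, x ∈ p then blk h.choose else i₀
  have hf : ∀ r i h, (∀ p ∈ g u r, InBlock blk i (h ∪ p)) → (∃ p ∈ g u r, p.Nonempty) →
      f r = i := by
    rintro r i h hr ⟨p, hp, x, hx⟩
    have hex : ∃ x, ∃ p ∈ g u r, x ∈ p := ⟨x, p, hp, hx⟩
    obtain ⟨p', hp', hxp'⟩ := hex.choose_spec
    simp only [f, dif_pos hex]
    exact hr p' hp' _ (Or.inr hxp')
  let bad : Finset ι := (Finset.univ.filter fun r => (g u r).Nonempty).image f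
  have hbad : ∀ r i h, (∀ p ∈ g u r, InBlock blk i (h ∪ p)) → (∃ p ∈ g u r, p.Nonempty) →
      i ∈ bad := by
    rintro r i h hr ⟨p, hp, hpn⟩
    rw [← hf r i h hr ⟨p, hp, hpn⟩]
    exact Finset.mem_image_of_mem _ (by simpa using ⟨p, hp⟩)
  -- A register is nonempty at one time only, so the covering systems need no index besides the
  -- register.
  refine ⟨bad, κ, hκ, fun r => g (P.time r) r, ?_, hs, ?_⟩
  · refine Finset.card_image_le.trans ?_
    rw [← Set.ncard_coe_finset]
    simpa using hk u huT
  intro i hi m hm hmi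
  obtain ⟨t, ht⟩ := hgood m hm
  have hut := hmin m hm t ht
  obtain ⟨htT, -, r, i', hmr, hrS, hri⟩ := ht
  have hmn : m.Nonempty := (hS1 _ (hAS hm)).nonempty
  obtain rfl : i' = i := (hri m hmr).eq hmi hmn
  -- At time `u` the register holding `m` would make its block bad, so the gate to be recomputed
  -- comes strictly later.
  have htu : t ≠ u := by
    rintro rfl
    exact hi (hbad r i' ∅ (by simpa using hri) ⟨m, hmr, hmn⟩)
  obtain ⟨d, rfl⟩ : ∃ d, t = u + d + 1 := ⟨t - u - 1, by omega⟩
  have hi₀ : i₀ ∈ bad := hbad r₀ i₀ ∅ (by simpa using hr₀i) ⟨m₀, hr₀, hm₀n⟩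
  have htime : u + d + 1 = P.time r := P.eq_time _ _ ⟨m, hmr⟩
  refine ⟨r, ?_, ?_, κ, hκ, P.restart u m₀ d r, hs, ?_, ?_⟩
  · change m ∈ g (P.time r) r
    rwa [← htime]
  · change ∀ m' ∈ g (P.time r) r, _
    rw [← htime]
    exact fun m' hm' => ⟨hrS hm', hri m' hm'⟩
  · intro t ht
    change t ≤ d at ht
    -- The register `r₁` holds `m₀` and is deleted, so at most `k` of the `k + 1` registers remain
    -- nonempty.
    obtain ⟨r₁, hr₁, -⟩ := hpath (u + t) (by omega) (by omega)
    have h1 := hk (u + t) (by omega)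
    have h2 : {r | ((P.restart u m₀ d r).val t r).Nonempty} ⊂ {r | (g (u + t) r).Nonempty} := by
      refine ⟨fun r hr => hr.mono (P.restartVal_subset u m₀ t r), fun hsub => ?_⟩
      exact P.not_mem_of_restartVal_nonempty u m₀ t r₁
        (hsub (show r₁ ∈ {r | (g (u + t) r).Nonempty} from ⟨m₀, hr₁⟩)) hr₁
    have h3 := Set.ncard_lt_ncard h2 (Set.toFinite _)
    exact Nat.le_of_lt_succ (h3.trans_le h1)
  · change g (P.time r) r = (P.gate (u + d) r).eval (P.restartVal u m₀ d)
    rw [← htime]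
    have e := P.val_succ (u + d) r
    rw [← hg] at e
    rw [e]
    refine subset_antisymm ?_ (Gate.eval_mono (P.restartVal_subset u m₀ d) _)
    refine Gate.eval_subset_of_completable (R := InBlock blk i') ?_ _ ∅ ?_
    -- `m₀` cannot be completed inside block `i'`, because its own block `i₀` is bad. A nonconstant
    -- content at time `u` that could be completed there would make `i'` bad.
    · refine P.subset_restartVal u m₀ ?_ ?_ d
      · intro h hh
        have : i₀ = i' := (hr₀i m₀ hr₀).eq (hh.mono Set.subset_union_right) hm₀n
        exact hi (this ▸ hi₀)
      · intro r h hr p hp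
        by_contra hpn
        exact hi (hbad r i' h hr ⟨p, hp, Set.nonempty_iff_ne_empty.2 hpn⟩)
    · rw [← e]
      simpa using hri

/-! ### Computations of set systems of bounded depth -/

/-- The unions of members, one from each set system of the list. -/
def listJoins (L : List (Set (Set σ))) : Set (Set σ) := L.foldr joins {∅}

/-- The union of the set systems of a list. -/
def listUnion (L : List (Set (Set σ))) : Set (Set σ) := {m | ∃ A ∈ L, m ∈ A}

theorem restrict_listJoins (ψ : τ → σ) (L : List (Set (Set σ))) :
    restrict ψ (listJoins L) = listJoins (L.map (restrict ψ)) := by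
  induction L with
  | nil => simp [listJoins, restrict]
  | cons A L ih => exact (restrict_joins ψ _ _).trans (congrArg _ ih)

theorem restrict_listUnion (ψ : τ → σ) (L : List (Set (Set σ))) :
    restrict ψ (listUnion L) = listUnion (L.map (restrict ψ)) := by
  ext m
  simp only [restrict, listUnion, Set.mem_image, Set.mem_ofPred_eq, List.mem_map]
  constructor
  · rintro ⟨m, ⟨A, hA, hm⟩, rfl⟩
    exact ⟨_, ⟨A, hA, rfl⟩, m, hm, rfl⟩
  · rintro ⟨_, ⟨A, hA, rfl⟩, m, hm, rfl⟩
    exact ⟨m, ⟨A, hA, hm⟩, rfl⟩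

/-- Factors are split off one at a time by `joins_block`: constant ones are dropped, and either a
single factor remains or two nonconstant parts force one block. -/
theorem listJoins_block {blk : σ → ι} {S : Set (Set σ)} (hS1 : ∀ m ∈ S, m.Nontrivial)
    (hS2 : ∀ m ∈ S, ∃ i, InBlock blk i m) (L : List (Set (Set σ))) (hL : listJoins L ⊆ S)
    {m : Set σ} (hm : m ∈ listJoins L) :
    (∃ A ∈ L, m ∈ A ∧ A ⊆ S) ∨ ∃ i, ∀ m' ∈ listJoins L, InBlock blk i m' := by
  induction L with
  | nil =>
    have h := hS1 m (hL hm)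
    have : m = ∅ := hm
    simp_all
  | cons A L ih =>
    have e : listJoins (A :: L) = joins A (listJoins L) := rfl
    rw [e] at hL hm ⊢
    have hne := hm
    obtain ⟨p, hp, q, hq, -⟩ := hne
    rcases joins_block (fun m' hm' => hS2 m' (hL hm')) ⟨p, hp⟩ ⟨q, hq⟩ with h | h | h
    · rw [h, joins_comm, joins_singleton_empty] at hL hm ⊢
      rcases ih hL hm with ⟨B, hB, h⟩ | h
      exacts [Or.inl ⟨B, List.mem_cons_of_mem _ hB, h⟩, Or.inr h]
    · rw [h, joins_singleton_empty] at hL hm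
      exact Or.inl ⟨A, List.mem_cons_self, hm, hL⟩
    · exact Or.inr h

/-- The set systems `val v` are computed by leaves, sums and products. -/
def IsDepthComp (val : κ → Set (Set σ)) (depth : κ → ℕ) : Prop :=
  ∀ v, IsLeafSet (val v) ∨ ∃ ch : List κ, (∀ u ∈ ch, depth u < depth v) ∧
    (val v = listUnion (ch.map val) ∨ val v = listJoins (ch.map val))

/-- `A` is computed at depth at most `k` by a computation with at most `s` nodes. -/
def DepthComp (k s : ℕ) (A : Set (Set σ)) : Prop :=
  ∃ (κ : Type) (_ : Fintype κ) (val : κ → Set (Set σ)) (depth : κ → ℕ) (v : κ),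
    Fintype.card κ ≤ s ∧ IsDepthComp val depth ∧ depth v ≤ k ∧ val v = A

theorem DepthComp.restrict {k s : ℕ} {A : Set (Set σ)} (h : DepthComp k s A) {ψ : τ → σ}
    (hψ : Function.Injective ψ) : DepthComp k s (restrict ψ A) := by
  obtain ⟨κ, hκ, val, depth, v, hs, hval, hv, rfl⟩ := h
  refine ⟨κ, hκ, fun u => MonotoneCircuit.restrict ψ (val u), depth, v, hs, fun u => ?_, hv, rfl⟩
  rcases hval u with h | ⟨ch, hch, h | h⟩
  · exact Or.inl (h.restrict hψ)
  · refine Or.inr ⟨ch, hch, Or.inl ?_⟩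
    simp only [h, restrict_listUnion, List.map_map, Function.comp_def]
  · refine Or.inr ⟨ch, hch, Or.inr ?_⟩
    simp only [h, restrict_listJoins, List.map_map, Function.comp_def]

/-- At depth zero only leaves are computed. -/
theorem DepthComp.isLeafSet {s : ℕ} {A : Set (Set σ)} (h : DepthComp 0 s A)
    (hA : A ≠ {∅}) : IsLeafSet A := by
  obtain ⟨κ, hκ, val, depth, v, hs, hval, hv, rfl⟩ := h
  rcases hval v with h | ⟨ch, hch, h⟩
  · exact h
  · have : ch = [] := by
      refine List.eq_nil_iff_forall_not_mem.2 fun u hu => ?_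
      have := hch u hu
      omega
    subst this
    rcases h with h | h
    · rw [h]
      simp [listUnion, IsLeafSet]
    · exact absurd h hA

/-- As long as the contents stay inside `S`, a sum passes `m` to a child, and so does a product with
only one nonconstant factor. The descent cannot end at a leaf, since members of `S` have two
elements; it ends at a product inside one block. -/
theorem IsDepthComp.descend {blk : σ → ι} {S : Set (Set σ)} (hS1 : ∀ m ∈ S, m.Nontrivial)
    (hS2 : ∀ m ∈ S, ∃ i, InBlock blk i m) {val : κ → Set (Set σ)} {depth : κ → ℕ}
    (hval : IsDepthComp val depth) (d : ℕ) : ∀ v, depth v = d → val v ⊆ S → ∀ m ∈ val v,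
      (∃ i, ∀ m' ∈ val v, InBlock blk i m') ∨ ∃ u, depth u < depth v ∧ m ∈ val u ∧ val u ⊆ S ∧
        ∃ i, ∀ m' ∈ val u, InBlock blk i m' := by
  induction d using Nat.strong_induction_on with
  | _ d ih =>
    intro v hd hvS m hm
    have key : ∀ u, depth u < depth v → m ∈ val u → val u ⊆ S →
        ∃ u, depth u < depth v ∧ m ∈ val u ∧ val u ⊆ S ∧ ∃ i, ∀ m' ∈ val u, InBlock blk i m' := by
      intro u hu hmu huS
      rcases ih _ (hd ▸ hu) u rfl huS m hmu with h | ⟨w, hw, h⟩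
      exacts [⟨u, hu, hmu, huS, h⟩, ⟨w, hw.trans hu, h⟩]
    rcases hval v with h | ⟨ch, hch, h | h⟩
    · exact absurd (h m hm) (Set.not_subsingleton_iff.2 (hS1 m (hvS hm)))
    · right
      rw [h] at hm
      obtain ⟨A, hA, hmA⟩ := hm
      obtain ⟨u, hu, rfl⟩ := List.mem_map.1 hA
      refine key u (hch u hu) hmA fun m' hm' => hvS ?_
      rw [h]
      exact ⟨_, hA, hm'⟩
    · rw [h] at hm hvS
      rcases listJoins_block hS1 hS2 _ hvS hm with ⟨A, hA, hmA, hAS⟩ | h'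
      · obtain ⟨u, hu, rfl⟩ := List.mem_map.1 hA
        exact Or.inr (key u (hch u hu) hmA hAS)
      · exact Or.inl (h ▸ h')

/-- A set system inside `S` computed at depth `k + 1` is covered by set systems inside single
blocks which are computed at depth `k`. -/
theorem DepthComp.cover {blk : σ → ι} {S : Set (Set σ)}
    (hS1 : ∀ m ∈ S, m.Nontrivial) (hS2 : ∀ m ∈ S, ∃ i, InBlock blk i m) {k s : ℕ}
    {A : Set (Set σ)} (hA : DepthComp (k + 1) s A) (hAS : A ⊆ S)
    (hblk : ¬ ∃ i, ∀ m ∈ A, InBlock blk i m) :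
    ∃ (κ : Type) (_ : Fintype κ) (H : κ → Set (Set σ)),
      Fintype.card κ ≤ s ∧ ∀ i, ∀ m ∈ A, InBlock blk i m → ∃ r, m ∈ H r ∧
        (∀ m' ∈ H r, m' ∈ S ∧ InBlock blk i m') ∧ DepthComp k s (H r) := by
  obtain ⟨κ, hκ, val, depth, v, hs, hval, hv, rfl⟩ := hA
  refine ⟨κ, hκ, val, hs, fun i m hm hmi => ?_⟩
  rcases hval.descend hS1 hS2 _ v rfl hAS m hm with h | ⟨u, hu, hmu, huS, i', hi'⟩
  · exact (hblk h).elim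
  · obtain rfl := (hi' m hmu).eq hmi (hS1 m (hAS hm)).nonempty
    exact ⟨u, hmu, fun m' hm' => ⟨huS hm', hi' m' hm'⟩, κ, hκ, val, depth, u, hs, hval, by omega,
      rfl⟩

/-! ### The set systems of the polynomials `P^l_k` -/

/-- Indices of the variables of `P^l_k`. -/
def Idx (l : ℕ) : ℕ → Type
  | 0 => Unit
  | k + 1 => Fin l × Fin l × Idx l k

/-- Monomials of `P^l_k`: a choice at every sum. -/
def Choice (l : ℕ) : ℕ → Type
  | 0 => Unit
  | k + 1 => Fin l × (Fin l → Choice l k)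

instance Choice.fintype (l : ℕ) : ∀ k, Fintype (Choice l k)
  | 0 => inferInstanceAs (Fintype Unit)
  | k + 1 =>
    haveI := Choice.fintype l k
    inferInstanceAs (Fintype (Fin l × (Fin l → Choice l k)))

/-- The variables of a monomial of `P^l_k`. -/
def Choice.vars {l : ℕ} : ∀ {k : ℕ}, Choice l k → Set (Idx l k)
  | 0, _ => Set.univ
  | k + 1, ω => {x : Fin l × Fin l × Idx l k | x.1 = ω.1 ∧ x.2.2 ∈ (ω.2 x.2.1).vars}

/-- The set system of `P^l_k`. -/
def monos (l k : ℕ) : Set (Set (Idx l k)) := Set.range Choice.vars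

/-- The top level block of a variable. -/
def Idx.block {l k : ℕ} (x : Idx l (k + 1)) : Fin l := x.1

/-- The embedding of the variables of a copy of `P^l_k` into those of `P^l_{k+1}`. -/
def Idx.copy {l k : ℕ} (i j : Fin l) (x : Idx l k) : Idx l (k + 1) :=
  ((i, j, x) : Fin l × Fin l × Idx l k)

theorem Idx.copy_injective {l k : ℕ} (i j : Fin l) :
    Function.Injective (Idx.copy i j : Idx l k → Idx l (k + 1)) := by
  intro x y h
  have h' : ((i, j, x) : Fin l × Fin l × Idx l k) = (i, j, y) := h
  simpa using h'

theorem Choice.nonempty_vars {l : ℕ} (hl : 0 < l) : ∀ {k : ℕ} (ω : Choice l k), ω.vars.Nonempty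
  | 0, _ => ⟨(), trivial⟩
  | k + 1, ω => by
    obtain ⟨x, hx⟩ := Choice.nonempty_vars hl (ω.2 ⟨0, hl⟩)
    exact ⟨Idx.copy ω.1 ⟨0, hl⟩ x, rfl, hx⟩

theorem Choice.inBlock_vars {l k : ℕ} (ω : Choice l (k + 1)) :
    InBlock Idx.block ω.1 ω.vars := fun _ hx => hx.1

theorem Choice.exists_three {l k : ℕ} (hl : 3 ≤ l) (ω : Choice l (k + 1)) :
    ∃ x ∈ ω.vars, ∃ y ∈ ω.vars, ∃ z ∈ ω.vars, x ≠ y ∧ x ≠ z ∧ y ≠ z := by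
  have key : ∀ j : Fin l, ∃ x : Idx l k, Idx.copy ω.1 j x ∈ ω.vars := fun j => by
    obtain ⟨x, hx⟩ := Choice.nonempty_vars (by omega) (ω.2 j)
    exact ⟨x, rfl, hx⟩
  have hne : ∀ (j j' : Fin l) (x x' : Idx l k), j ≠ j' →
      Idx.copy ω.1 j x ≠ Idx.copy ω.1 j' x' := by
    intro j j' x x' hj h
    have h' : ((ω.1, j, x) : Fin l × Fin l × Idx l k) = (ω.1, j', x') := h
    simp_all
  obtain ⟨x, hx⟩ := key ⟨0, by omega⟩
  obtain ⟨y, hy⟩ := key ⟨1, by omega⟩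
  obtain ⟨z, hz⟩ := key ⟨2, by omega⟩
  exact ⟨_, hx, _, hy, _, hz, hne _ _ _ _ (by simp), hne _ _ _ _ (by simp),
    hne _ _ _ _ (by simp)⟩

theorem Choice.nontrivial_vars {l k : ℕ} (hl : 3 ≤ l) (ω : Choice l (k + 1)) :
    ω.vars.Nontrivial := by
  obtain ⟨x, hx, y, hy, -, -, h, -⟩ := ω.exists_three hl
  exact ⟨x, hx, y, hy, h⟩

theorem Choice.preimage_copy {l k : ℕ} (ω : Choice l (k + 1)) (j : Fin l) :
    Idx.copy ω.1 j ⁻¹' ω.vars = (ω.2 j).vars := by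
  ext x
  exact ⟨fun h => h.2, fun h => ⟨rfl, h⟩⟩

theorem Choice.card_succ (l k : ℕ) :
    Fintype.card (Choice l (k + 1)) = l * Fintype.card (Choice l k) ^ l := by
  change Fintype.card (Fin l × (Fin l → Choice l k)) = _
  simp [Fintype.card_prod]

theorem Choice.card_pos {l : ℕ} (hl : 0 < l) (k : ℕ) : 0 < Fintype.card (Choice l k) := by
  induction k with
  | zero => exact Fintype.card_pos_iff.2 ⟨()⟩
  | succ k ih =>
    rw [Choice.card_succ]
    positivity

/-! ### Density and the counting argument -/

open Classical in
/-- `A` contains more than half of the monomials of `P^l_k`. -/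
def Dense {l k : ℕ} (A : Set (Set (Idx l k))) : Prop :=
  Fintype.card (Choice l k) < 2 * (Finset.univ.filter fun ω : Choice l k => ω.vars ∈ A).card

open Classical in
/-- If a dense set system is covered, up to few blocks, by few set systems inside single blocks,
then one of these has a dense restriction to a copy of `P^l_k`. -/
theorem Dense.exists_restrict {l k s b : ℕ} {A : Set (Set (Idx l (k + 1)))} (hA : Dense A)
    (hb : 4 * b ≤ l) (hs : 4 * s < 2 ^ l) {bad : Finset (Fin l)} (hbad : bad.card ≤ b) {κ : Type}
    [Fintype κ] (hκ : Fintype.card κ ≤ s) {H : κ → Set (Set (Idx l (k + 1)))}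
    {Q : Set (Set (Idx l (k + 1))) → Prop}
    (hH : ∀ i ∉ bad, ∀ m ∈ A, InBlock Idx.block i m → ∃ r, m ∈ H r ∧
      (∀ m' ∈ H r, m' ∈ monos l (k + 1) ∧ InBlock Idx.block i m') ∧ Q (H r)) :
    ∃ B i j, Q B ∧ (∀ m ∈ B, m ∈ monos l (k + 1) ∧ InBlock Idx.block i m) ∧
      Dense (restrict (Idx.copy i j) B) := by
  set N := Fintype.card (Choice l k) with hN
  have hmk : ∀ (i : Fin l) (c : Fin l → Choice l k),
      InBlock Idx.block i (Choice.vars (k := k + 1) (i, c)) := fun i c =>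
    Choice.inBlock_vars (k := k) (i, c)
  let F : Fin l → Finset (Fin l → Choice l k) := fun i =>
    Finset.univ.filter fun c => Choice.vars (k := k + 1) (i, c) ∈ A
  have hF : (Finset.univ.filter fun ω : Choice l (k + 1) => ω.vars ∈ A).card =
      ∑ i, (F i).card := by
    rw [← Finset.card_sigma]
    refine Finset.card_bij' (fun ω _ => (⟨ω.1, ω.2⟩ : (_ : Fin l) × (Fin l → Choice l k)))
      (fun p _ => ((p.1, p.2) : Fin l × (Fin l → Choice l k))) ?_ ?_ ?_ ?_
    · intro ω hω
      exact Finset.mem_sigma.2 ⟨Finset.mem_univ _,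
        Finset.mem_filter.2 ⟨Finset.mem_univ _, (Finset.mem_filter.1 hω).2⟩⟩
    · intro p hp
      exact Finset.mem_filter.2 ⟨Finset.mem_univ _,
        (Finset.mem_filter.1 (Finset.mem_sigma.1 hp).2).2⟩
    · intro ω _
      rfl
    · intro p _
      rfl
  have hFle : ∀ i, (F i).card ≤ N ^ l := by
    intro i
    refine (Finset.card_le_univ _).trans ?_
    simp [hN]
  -- Of the more than `l * N ^ l / 2` monomials of `A`, the bad blocks hold at most `l * N ^ l / 4`,
  -- so some other block holds more than `N ^ l / 4`.
  obtain ⟨i, hi, hiF⟩ : ∃ i ∉ bad, N ^ l < 4 * (F i).card := by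
    by_contra! hcon
    unfold Dense at hA
    rw [hF, Choice.card_succ, ← hN, ← Finset.sum_add_sum_compl bad] at hA
    have h1 : ∑ i ∈ bad, (F i).card ≤ b * N ^ l :=
      (Finset.sum_le_card_nsmul _ _ _ fun i _ => hFle i).trans
        (by simpa using Nat.mul_le_mul_right _ hbad)
    have h2 : 4 * ∑ i ∈ badᶜ, (F i).card ≤ l * N ^ l := by
      rw [Finset.mul_sum]
      refine (Finset.sum_le_card_nsmul _ _ _ fun i hi => hcon i (by simpa using hi)).trans ?_
      rw [smul_eq_mul]
      refine Nat.mul_le_mul_right _ ((Finset.card_le_univ _).trans (by simp))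
    have h3 := Nat.mul_le_mul_right (N ^ l) hb
    nlinarith
  let R := {r : κ // (∀ m' ∈ H r, m' ∈ monos l (k + 1) ∧ InBlock Idx.block i m') ∧ Q (H r)}
  let D : R → Finset (Fin l → Choice l k) := fun r =>
    Finset.univ.filter fun c => Choice.vars (k := k + 1) (i, c) ∈ H r.1
  have hcov : F i ⊆ Finset.univ.biUnion D := by
    intro c hc
    obtain ⟨r, h1, h2⟩ := hH i hi _ (Finset.mem_filter.1 hc).2 (hmk i c)
    exact Finset.mem_biUnion.2 ⟨⟨r, h2⟩, Finset.mem_univ _, by simpa [D] using h1⟩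
  -- Pigeonhole over the at most `s` systems covering block `i`.
  obtain ⟨r, hr⟩ : ∃ r, N ^ l < 4 * s * (D r).card := by
    by_contra! hcon
    have hR : Fintype.card R ≤ s := (Fintype.card_subtype_le _).trans hκ
    have h1 : (F i).card ≤ ∑ r, (D r).card :=
      (Finset.card_le_card hcov).trans Finset.card_biUnion_le
    have h2 : 4 * s * ∑ r, (D r).card ≤ s * N ^ l := by
      rw [Finset.mul_sum]
      refine (Finset.sum_le_card_nsmul _ _ _ fun r _ => hcon r).trans ?_
      rw [smul_eq_mul]
      exact Nat.mul_le_mul_right _ (by simpa using hR)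
    rcases Nat.eq_zero_or_pos s with rfl | hs0
    · have : IsEmpty R := Fintype.card_eq_zero_iff.1 (Nat.le_zero.1 hR)
      simp at h1
      simp [h1] at hiF
    · have h4 : s * (4 * ∑ r, (D r).card) ≤ s * N ^ l := by linarith
      have := Nat.le_of_mul_le_mul_left h4 hs0
      omega
  refine ⟨H r.1, i, ?_⟩
  suffices ∃ j, Dense (restrict (Idx.copy i j) (H r.1)) by
    obtain ⟨j, hj⟩ := this
    exact ⟨j, r.2.2, r.2.1, hj⟩
  by_contra! hcon
  let E : Fin l → Finset (Choice l k) := fun j =>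
    Finset.univ.filter fun ω => ω.vars ∈ restrict (Idx.copy i j) (H r.1)
  -- A choice function counted by `D r` is determined by its coordinates, and each coordinate lies
  -- in the corresponding trace.
  have hDE : D r ⊆ Fintype.piFinset E := by
    intro c hc
    rw [Fintype.mem_piFinset]
    intro j
    simp only [E, Finset.mem_filter, Finset.mem_univ, true_and]
    exact ⟨_, (Finset.mem_filter.1 hc).2, Choice.preimage_copy (k := k) (i, c) j⟩
  have hE : ∀ j, 2 * (E j).card ≤ N := fun j => not_lt.1 (hcon j)
  have h1 : 2 ^ l * (D r).card ≤ N ^ l := by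
    calc 2 ^ l * (D r).card ≤ 2 ^ l * ∏ j, (E j).card :=
          Nat.mul_le_mul_left _ ((Finset.card_le_card hDE).trans (Fintype.card_piFinset E).le)
      _ = ∏ j, (2 * (E j).card) := by simp [Finset.prod_mul_distrib]
      _ ≤ ∏ _j : Fin l, N := Finset.prod_le_prod' fun j _ => hE j
      _ = N ^ l := by simp
  have h2 : 4 * s * (D r).card ≤ 2 ^ l * (D r).card := Nat.mul_le_mul_right _ hs.le
  omega

/-- One block carries a fraction `1 / l` of all monomials, which is at most a half. -/
theorem Dense.not_inBlock {l k : ℕ} (hl : 2 ≤ l) {A : Set (Set (Idx l (k + 1)))} (hA : Dense A) :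
    ¬ ∃ i, ∀ m ∈ A, InBlock Idx.block i m := by
  classical
  rintro ⟨i, hi⟩
  unfold Dense at hA
  have h1 : (Finset.univ.filter fun ω : Choice l (k + 1) => ω.vars ∈ A).card ≤
      Fintype.card (Choice l k) ^ l := by
    have : Fintype.card (Fin l → Choice l k) = Fintype.card (Choice l k) ^ l := by simp
    rw [← this]
    refine Finset.card_le_card_of_injOn (t := Finset.univ)
      (fun ω : Fin l × (Fin l → Choice l k) => ω.2)
      (fun _ _ => Finset.mem_coe.2 (Finset.mem_univ _)) ?_
    have hfst : ∀ ω : Choice l (k + 1), ω.vars ∈ A → ω.1 = i := fun ω hω =>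
      ω.inBlock_vars.eq (hi _ hω) (ω.nonempty_vars (by omega))
    intro ω hω ω' hω' h
    have hω := hfst ω (by simpa using hω)
    have hω' := hfst ω' (by simpa using hω')
    exact Prod.ext (hω.trans hω'.symm) h
  rw [Choice.card_succ] at hA
  have := Nat.mul_le_mul_right (Fintype.card (Choice l k) ^ l) hl
  omega

theorem Dense.nonempty {l k : ℕ} {A : Set (Set (Idx l k))} (hA : Dense A) : A.Nonempty := by
  classical
  by_contra h
  rw [Set.not_nonempty_iff_eq_empty] at h
  simp [Dense, h] at hA

/-- A monomial in block `i` is a product of monomials of the `l` copies in that block; its trace on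
copy `j` is the `j`-th of these. -/
theorem restrict_copy_subset {l k : ℕ} (hl : 0 < l) {i : Fin l} {B : Set (Set (Idx l (k + 1)))}
    (hB : ∀ m ∈ B, m ∈ monos l (k + 1) ∧ InBlock Idx.block i m) (j : Fin l) :
    restrict (Idx.copy i j) B ⊆ monos l k := by
  rintro _ ⟨m, hm, rfl⟩
  obtain ⟨⟨ω, rfl⟩, hi⟩ := hB m hm
  obtain rfl : ω.1 = i := ω.inBlock_vars.eq hi (ω.nonempty_vars hl)
  exact ⟨_, (ω.preimage_copy j).symm⟩

theorem monos_nontrivial {l k : ℕ} (hl : 3 ≤ l) : ∀ m ∈ monos l (k + 1), m.Nontrivial := by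
  rintro _ ⟨ω, rfl⟩
  exact ω.nontrivial_vars hl

theorem monos_inBlock {l k : ℕ} :
    ∀ m ∈ monos l (k + 1), ∃ i, InBlock (Idx.block : Idx l (k + 1) → Fin l) i m := by
  rintro _ ⟨ω, rfl⟩
  exact ⟨_, ω.inBlock_vars⟩

/-! ### Lower bounds for set systems -/

/-- No layered computation of width `k` and subexponential size computes most monomials of
`P^l_k`. -/
theorem not_widthComp {l s k : ℕ} (hl : 3 ≤ l) (hk : 4 * (k + 1) ≤ l) (hs : 4 * s < 2 ^ l)
    {A : Set (Set (Idx l (k + 1)))} (hA : A ⊆ monos l (k + 1)) (hd : Dense A) :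
    ¬ WidthComp (k + 1) s A := by
  induction k with
  | zero =>
    intro h
    obtain ⟨bad, κ, hκ, H, hbad, hcard, hH⟩ :=
      h.cover (monos_nontrivial hl) monos_inBlock hA (hd.not_inBlock (by omega))
    obtain ⟨B, i, j, hB, hBS, hBd⟩ := hd.exists_restrict hk hs hbad hcard hH
    obtain ⟨m, hm⟩ := Set.image_nonempty.1 hBd.nonempty
    obtain ⟨p, q, hp, hq, rfl⟩ := hB.eq_union hm
    obtain ⟨ω, hω⟩ := (hBS _ hm).1
    obtain ⟨x, hx, y, hy, z, hz, hxy, hxz, hyz⟩ := ω.exists_three hl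
    rw [hω] at hx hy hz
    -- Of three distinct variables two fall into the same one of `p` and `q`, which have at most one
    -- element each.
    rcases hx with hx | hx <;> rcases hy with hy | hy <;> rcases hz with hz | hz <;>
      first
        | exact hxy (hp hx hy) | exact hxz (hp hx hz) | exact hyz (hp hy hz)
        | exact hxy (hq hx hy) | exact hxz (hq hx hz) | exact hyz (hq hy hz)
  | succ k ih =>
    intro h
    obtain ⟨bad, κ, hκ, H, hbad, hcard, hH⟩ :=
      h.cover (monos_nontrivial hl) monos_inBlock hA (hd.not_inBlock (by omega))
    obtain ⟨B, i, j, hB, hBS, hBd⟩ := hd.exists_restrict hk hs hbad hcard hH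
    exact ih (by omega) (restrict_copy_subset (by omega) hBS j) hBd
      (hB.restrict (Idx.copy_injective i j))

/-- No computation of depth `k` and subexponential size computes most monomials of `P^l_k`. -/
theorem not_depthComp {l s k : ℕ} (hl : 3 ≤ l) (hs : 4 * s < 2 ^ l)
    {A : Set (Set (Idx l (k + 1)))} (hA : A ⊆ monos l (k + 1)) (hd : Dense A) :
    ¬ DepthComp (k + 1) s A := by
  induction k with
  | zero =>
    intro h
    obtain ⟨κ, hκ, H, hcard, hH⟩ :=
      h.cover (monos_nontrivial hl) monos_inBlock hA (hd.not_inBlock (by omega))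
    obtain ⟨B, i, j, hB, hBS, hBd⟩ := hd.exists_restrict (b := 0) (bad := ∅) (by omega) hs
      (by simp) hcard (fun i _ => hH i)
    obtain ⟨m, hm⟩ := Set.image_nonempty.1 hBd.nonempty
    have hnt := fun m hm => monos_nontrivial hl m (hBS m hm).1
    refine Set.not_subsingleton_iff.2 (hnt m hm) (hB.isLeafSet ?_ m hm)
    rintro rfl
    simpa using hnt ∅ rfl
  | succ k ih =>
    intro h
    obtain ⟨κ, hκ, H, hcard, hH⟩ :=
      h.cover (monos_nontrivial hl) monos_inBlock hA (hd.not_inBlock (by omega))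
    obtain ⟨B, i, j, hB, hBS, hBd⟩ := hd.exists_restrict (b := 0) (bad := ∅) (by omega) hs
      (by simp) hcard (fun i _ => hH i)
    exact ih (restrict_copy_subset (by omega) hBS j) hBd
      (hB.restrict (Idx.copy_injective i j))

/-! ### Supports of monotone polynomials -/

/-- The sets of variables of the monomials of a polynomial. -/
def supp {n : ℕ} (f : MvPolynomial (Fin n) ℝ) : Set (Set (Fin n)) :=
  {m | ∃ d, f.coeff d ≠ 0 ∧ ((d.support : Finset (Fin n)) : Set (Fin n)) = m}

section

variable {n : ℕ} {f g : MvPolynomial (Fin n) ℝ}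

theorem MonotonePoly.add (hf : MonotonePoly f) (hg : MonotonePoly g) : MonotonePoly (f + g) :=
  fun m => by
    rw [coeff_add]
    exact add_nonneg (hf m) (hg m)

theorem MonotonePoly.mul (hf : MonotonePoly f) (hg : MonotonePoly g) : MonotonePoly (f * g) :=
  fun m => by
    rw [coeff_mul]
    exact Finset.sum_nonneg fun p _ => mul_nonneg (hf _) (hg _)

theorem monotonePoly_C {c : ℝ} (hc : 0 ≤ c) : MonotonePoly (C c : MvPolynomial (Fin n) ℝ) :=
  fun m => by
    classical
    rw [coeff_C]
    split_ifs
    exacts [hc, le_rfl]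

theorem monotonePoly_X (i : Fin n) : MonotonePoly (X i : MvPolynomial (Fin n) ℝ) :=
  fun m => by
    classical
    rw [coeff_X]
    split_ifs
    exacts [zero_le_one, le_rfl]

theorem monotonePoly_sum (L : List (MvPolynomial (Fin n) ℝ)) (h : ∀ f ∈ L, MonotonePoly f) :
    MonotonePoly L.sum := by
  induction L with
  | nil => exact fun m => by simp
  | cons f L ih =>
    rw [List.sum_cons]
    exact (h f (by simp)).add (ih fun g hg => h g (by simp [hg]))

theorem monotonePoly_prod (L : List (MvPolynomial (Fin n) ℝ)) (h : ∀ f ∈ L, MonotonePoly f) :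
    MonotonePoly L.prod := by
  induction L with
  | nil => simpa using monotonePoly_C (n := n) zero_le_one
  | cons f L ih =>
    rw [List.prod_cons]
    exact (h f (by simp)).mul (ih fun g hg => h g (by simp [hg]))

theorem supp_zero : supp (0 : MvPolynomial (Fin n) ℝ) = ∅ := by
  simp [supp]

theorem supp_one : supp (1 : MvPolynomial (Fin n) ℝ) = {∅} := by
  classical
  ext m
  simp [supp, coeff_one, eq_comm]

theorem supp_X (i : Fin n) : supp (X i : MvPolynomial (Fin n) ℝ) = {{i}} := by
  classical
  ext m
  constructor
  · rintro ⟨d, hd, rfl⟩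
    rw [coeff_X] at hd
    have : Finsupp.single i 1 = d := by
      by_contra h
      simp [h] at hd
    simp [← this]
  · rintro rfl
    exact ⟨Finsupp.single i 1, by simp, by simp⟩

theorem isLeafSet_supp_C (c : ℝ) : IsLeafSet (supp (C c : MvPolynomial (Fin n) ℝ)) := by
  classical
  rintro _ ⟨d, hd, rfl⟩
  rw [coeff_C] at hd
  have : 0 = d := by
    by_contra h
    simp [h] at hd
  simp [← this]

theorem isLeafSet_supp_X (i : Fin n) : IsLeafSet (supp (X i : MvPolynomial (Fin n) ℝ)) := by
  rw [supp_X]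
  rintro _ rfl
  exact Set.subsingleton_singleton

/-- Nonnegative coefficients vanish in the sum only if both vanish. -/
theorem supp_add (hf : MonotonePoly f) (hg : MonotonePoly g) :
    supp (f + g) = supp f ∪ supp g := by
  ext m
  simp only [supp, Set.mem_union, Set.mem_ofPred_eq, coeff_add, ← exists_or]
  refine exists_congr fun d => ?_
  have h1 := hf d
  have h2 := hg d
  have : coeff d f + coeff d g ≠ 0 ↔ coeff d f ≠ 0 ∨ coeff d g ≠ 0 := by
    rw [Ne, add_eq_zero_iff_of_nonneg h1 h2]
    tauto
  rw [this]
  tauto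

theorem support_add_coe (p q : Fin n →₀ ℕ) :
    (((p + q).support : Finset (Fin n)) : Set (Fin n)) =
      (p.support : Set (Fin n)) ∪ (q.support : Set (Fin n)) := by
  ext x
  simp
  omega

/-- Each coefficient of the product is a sum of nonnegative terms, so one positive term keeps it
positive. Exponents are forgotten, which makes supports add as unions. -/
theorem supp_mul (hf : MonotonePoly f) (hg : MonotonePoly g) :
    supp (f * g) = joins (supp f) (supp g) := by
  ext m
  constructor
  · rintro ⟨d, hd, rfl⟩
    rw [coeff_mul] at hd
    obtain ⟨⟨p, q⟩, hpq, hne⟩ := Finset.exists_ne_zero_of_sum_ne_zero hd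
    obtain rfl : p + q = d := Finset.HasAntidiagonal.mem_antidiagonal.1 hpq
    refine ⟨_, ⟨p, left_ne_zero_of_mul hne, rfl⟩, _, ⟨q, right_ne_zero_of_mul hne, rfl⟩, ?_⟩
    exact (support_add_coe p q).symm
  · rintro ⟨_, ⟨p, hp, rfl⟩, _, ⟨q, hq, rfl⟩, rfl⟩
    refine ⟨p + q, ?_, support_add_coe p q⟩
    rw [coeff_mul]
    refine ((Finset.sum_pos_iff_of_nonneg fun x _ => mul_nonneg (hf _) (hg _)).2
      ⟨(p, q), Finset.HasAntidiagonal.mem_antidiagonal.2 rfl, ?_⟩).ne'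
    exact mul_pos ((hf p).lt_of_ne' hp) ((hg q).lt_of_ne' hq)

theorem supp_sum (L : List (MvPolynomial (Fin n) ℝ)) (h : ∀ f ∈ L, MonotonePoly f) :
    supp L.sum = listUnion (L.map supp) := by
  induction L with
  | nil => simp [supp_zero, listUnion]
  | cons f L ih =>
    have hL : ∀ f ∈ L, MonotonePoly f := fun g hg => h g (by simp [hg])
    rw [List.sum_cons, supp_add (h f (by simp)) (monotonePoly_sum L hL), ih hL]
    ext m
    simp [listUnion]

theorem supp_prod (L : List (MvPolynomial (Fin n) ℝ)) (h : ∀ f ∈ L, MonotonePoly f) :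
    supp L.prod = listJoins (L.map supp) := by
  induction L with
  | nil => simp [supp_one, listJoins]
  | cons f L ih =>
    have hL : ∀ f ∈ L, MonotonePoly f := fun g hg => h g (by simp [hg])
    rw [List.prod_cons, supp_mul (h f (by simp)) (monotonePoly_prod L hL), ih hL]
    rfl

end

/-! ### Circuits compute set systems -/

namespace Circuit

variable {n : ℕ} (C : Circuit n)

theorem polyAt_var {v : Fin C.size} {i : Fin n} (h : C.node v = .var i) : C.polyAt v = X i := by
  rw [polyAt]
  split <;> simp_all

theorem polyAt_const {v : Fin C.size} {c : ℝ} (h : C.node v = .const c) :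
    C.polyAt v = MvPolynomial.C c := by
  rw [polyAt]
  split <;> simp_all

theorem polyAt_add {v : Fin C.size} {ch : Multiset (Fin C.size)} (h : C.node v = .add ch) :
    C.polyAt v = (ch.map C.polyAt).sum := by
  rw [polyAt]
  split
  · simp_all
  · simp_all
  · rename_i ch' h'
    obtain rfl : ch = ch' := by simpa [h] using h'
    exact congrArg Multiset.sum (Multiset.attach_map_val' ch C.polyAt)
  · simp_all

theorem polyAt_mul {v : Fin C.size} {ch : Multiset (Fin C.size)} (h : C.node v = .mul ch) :
    C.polyAt v = (ch.map C.polyAt).prod := by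
  rw [polyAt]
  split
  · simp_all
  · simp_all
  · simp_all
  · rename_i ch' h'
    obtain rfl : ch = ch' := by simpa [h] using h'
    exact congrArg Multiset.prod (Multiset.attach_map_val' ch C.polyAt)

theorem depthAt_leaf {v : Fin C.size} (h : (C.node v).IsLeaf) : C.depthAt v = 0 := by
  rw [depthAt]
  split <;> simp_all [Node.IsLeaf]

theorem depthAt_gate {v : Fin C.size} (h : ¬ (C.node v).IsLeaf) :
    C.depthAt v = 1 + ((C.node v).children.map C.depthAt).sup := by
  rw [depthAt]
  split
  · simp_all [Node.IsLeaf]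
  · simp_all [Node.IsLeaf]
  · rename_i ch h'
    have e : (C.node v).children = ch := by rw [h']; rfl
    rw [e]
    exact congrArg (1 + Multiset.sup ·) (Multiset.attach_map_val' ch C.depthAt)
  · rename_i ch h'
    have e : (C.node v).children = ch := by rw [h']; rfl
    rw [e]
    exact congrArg (1 + Multiset.sup ·) (Multiset.attach_map_val' ch C.depthAt)

theorem depthAt_child_lt {v u : Fin C.size} (hu : u ∈ (C.node v).children) :
    C.depthAt u < C.depthAt v := by
  have h : ¬ (C.node v).IsLeaf := by
    intro h
    cases hv : C.node v <;> simp_all [Node.IsLeaf, Node.children]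
  rw [C.depthAt_gate h, add_comm, Nat.lt_succ_iff]
  exact Multiset.le_sup (Multiset.mem_map_of_mem _ hu)

variable {C}

theorem Monotone.monotonePoly (hC : C.Monotone) (v : Fin C.size) : MonotonePoly (C.polyAt v) := by
  induction v using WellFoundedLT.induction with
  | _ v ih =>
    cases h : C.node v with
    | var i =>
      rw [C.polyAt_var h]
      exact monotonePoly_X i
    | const c =>
      rw [C.polyAt_const h]
      exact monotonePoly_C (hC v c h)
    | add ch =>
      rw [C.polyAt_add h, ← Multiset.sum_toList]
      refine monotonePoly_sum _ fun f hf => ?_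
      obtain ⟨u, hu, rfl⟩ := Multiset.mem_map.1 (Multiset.mem_toList.1 hf)
      exact ih u (C.child_lt v u (by rwa [h]))
    | mul ch =>
      rw [C.polyAt_mul h, ← Multiset.prod_toList]
      refine monotonePoly_prod _ fun f hf => ?_
      obtain ⟨u, hu, rfl⟩ := Multiset.mem_map.1 (Multiset.mem_toList.1 hf)
      exact ih u (C.child_lt v u (by rwa [h]))

theorem isLeafSet_supp_polyAt {v : Fin C.size} (h : (C.node v).IsLeaf) :
    IsLeafSet (supp (C.polyAt v)) := by
  cases hv : C.node v with
  | var i =>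
    rw [C.polyAt_var hv]
    exact isLeafSet_supp_X i
  | const c =>
    rw [C.polyAt_const hv]
    exact isLeafSet_supp_C c
  | add ch => simp [hv, Node.IsLeaf] at h
  | mul ch => simp [hv, Node.IsLeaf] at h

theorem Monotone.isDepthComp (hC : C.Monotone) :
    IsDepthComp (fun v => supp (C.polyAt v)) C.depthAt := by
  intro v
  cases h : C.node v with
  | var i => exact Or.inl (isLeafSet_supp_polyAt (by simp [h, Node.IsLeaf]))
  | const i => exact Or.inl (isLeafSet_supp_polyAt (by simp [h, Node.IsLeaf]))
  | add ch =>
    obtain ⟨L, rfl⟩ : ∃ L : List (Fin C.size), ch = L := ⟨_, ch.coe_toList.symm⟩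
    refine Or.inr ⟨L, fun u hu => C.depthAt_child_lt ?_, Or.inl ?_⟩
    · rw [h]
      exact hu
    · change supp (C.polyAt v) = _
      rw [C.polyAt_add h, Multiset.map_coe, Multiset.sum_coe, supp_sum]
      · simp [Function.comp_def]
      · intro f hf
        obtain ⟨u, -, rfl⟩ := List.mem_map.1 hf
        exact hC.monotonePoly u
  | mul ch =>
    obtain ⟨L, rfl⟩ : ∃ L : List (Fin C.size), ch = L := ⟨_, ch.coe_toList.symm⟩
    refine Or.inr ⟨L, fun u hu => C.depthAt_child_lt ?_, Or.inr ?_⟩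
    · rw [h]
      exact hu
    · change supp (C.polyAt v) = _
      rw [C.polyAt_mul h, Multiset.map_coe, Multiset.prod_coe, supp_prod]
      · simp [Function.comp_def]
      · intro f hf
        obtain ⟨u, -, rfl⟩ := List.mem_map.1 hf
        exact hC.monotonePoly u

theorem Monotone.depthComp (hC : C.Monotone) {k s : ℕ} (hk : C.depth ≤ k) (hs : C.size ≤ s) :
    DepthComp k s (supp C.poly) :=
  ⟨Fin C.size, inferInstance, _, C.depthAt, C.output, by simpa using hs, hC.isDepthComp,
    (Finset.le_sup (Finset.mem_univ _)).trans hk, rfl⟩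

open Classical in
/-- The set system at a node of layer `t`, where the first layer is ignored. -/
noncomputable def Layering.val (L : C.Layering) (t : ℕ) (v : Fin C.size) : Set (Set (Fin n)) :=
  if L.layer v = t ∧ 2 ≤ t then supp (C.polyAt v) else ∅

/-- Children in the first layer are leaves and become leaf operands; all others lie exactly one
layer below and are available as registers. A leaf in any layer is a gate of its own. -/
theorem Layering.exists_gate (hC : C.Monotone) (h2 : C.FanInTwo) (L : C.Layering)
    (v : Fin C.size) :
    ∃ o : Gate (Fin C.size) (Fin n), o.eval (L.val (L.layer v - 1)) = supp (C.polyAt v) := by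
  have key : ∀ u ∈ (C.node v).children, ∃ x : Operand (Fin C.size) (Fin n),
      x.eval (L.val (L.layer v - 1)) = supp (C.polyAt u) := by
    intro u hu
    by_cases h1 : L.layer u = 1
    · exact ⟨.leaf _ (isLeafSet_supp_polyAt (L.leaf_of_one u h1)), rfl⟩
    · have hlv := (L.child v u hu).resolve_left h1
      have hlu := L.one_le u
      refine ⟨.reg u, ?_⟩
      simp only [Operand.eval, val]
      rw [if_pos (by omega)]
  by_cases hl : (C.node v).IsLeaf
  · exact ⟨Gate.ofLeaf _ (isLeafSet_supp_polyAt hl), Gate.eval_ofLeaf _ _ _⟩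
  obtain ⟨a, b, hab⟩ := Multiset.card_eq_two.1 (h2 v hl)
  obtain ⟨x, hx⟩ := key a (by simp [hab])
  obtain ⟨y, hy⟩ := key b (by simp [hab])
  cases h : C.node v with
  | var i => simp [h, Node.IsLeaf] at hl
  | const i => simp [h, Node.IsLeaf] at hl
  | add ch =>
    obtain rfl : ch = {a, b} := by simpa [h, Node.children] using hab
    refine ⟨.add x y, ?_⟩
    rw [C.polyAt_add h]
    simp [Gate.eval, hx, hy, supp_add (hC.monotonePoly a) (hC.monotonePoly b)]
  | mul ch =>
    obtain rfl : ch = {a, b} := by simpa [h, Node.children] using hab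
    refine ⟨.mul x y, ?_⟩
    rw [C.polyAt_mul h]
    simp [Gate.eval, hx, hy, supp_mul (hC.monotonePoly a) (hC.monotonePoly b)]

theorem Monotone.widthComp (hC : C.Monotone) (h2 : C.FanInTwo) (L : C.Layering) {k s : ℕ}
    (hk : L.width ≤ k) (hs : C.size ≤ s) : WidthComp k s (supp C.poly) := by
  classical
  have hg : ∀ t v, ∃ o : Gate (Fin C.size) (Fin n), o.eval (L.val t) = L.val (t + 1) v := by
    intro t v
    by_cases h : L.layer v = t + 1 ∧ 2 ≤ t + 1
    · obtain ⟨o, ho⟩ := L.exists_gate hC h2 v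
      refine ⟨o, ?_⟩
      have e : L.layer v - 1 = t := by omega
      rw [e] at ho
      rw [ho, Layering.val, if_pos h]
    · exact ⟨Gate.ofLeaf ∅ isLeafSet_empty, by rw [Gate.eval_ofLeaf, Layering.val, if_neg h]⟩
  choose gate hgate using hg
  obtain ⟨o, ho⟩ := L.exists_gate hC h2 C.output
  refine ⟨Fin C.size, inferInstance,
    { val := L.val
      gate := gate
      time := L.layer
      -- The output node itself becomes the gate `out`, so the registers are read one layer below
      -- it.
      length := L.layer C.output - 1
      out := o
      val_zero := fun r => by simp [Layering.val]
      val_succ := fun t r => (hgate t r).symm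
      eq_time := fun t r h => ?_ }, by simpa using hs, fun t _ => ?_, ho.symm⟩
  · by_contra hne
    rw [Layering.val, if_neg (fun h' => hne h'.1.symm)] at h
    exact Set.not_nonempty_empty h
  · have hsub : {r | (L.val t r).Nonempty} ⊆
        ((Finset.univ.filter fun v => L.layer v = t ∧ 2 ≤ t : Finset (Fin C.size)) :
          Set (Fin C.size)) := by
      intro v hv
      by_contra hne
      have hne : ¬ (L.layer v = t ∧ 2 ≤ t) := by simpa using hne
      change (L.val t v).Nonempty at hv
      rw [Layering.val, if_neg hne] at hv
      exact Set.not_nonempty_empty hv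
    refine (Set.ncard_le_ncard hsub).trans ?_
    rw [Set.ncard_coe_finset]
    rcases Finset.eq_empty_or_nonempty
      (Finset.univ.filter fun v => L.layer v = t ∧ 2 ≤ t : Finset (Fin C.size)) with h | ⟨v, hv⟩
    · simp [h]
    · obtain ⟨hv, ht⟩ := (Finset.mem_filter.1 hv).2
      refine le_trans (Finset.card_le_card fun u hu => ?_) (le_trans (Finset.le_sup
        (f := fun i => (Finset.univ.filter fun v => L.layer v = i).card) (b := t) ?_) hk)
      · exact Finset.mem_filter.2 ⟨Finset.mem_univ _, (Finset.mem_filter.1 hu).2.1⟩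
      · exact Finset.mem_filter.2 ⟨Finset.mem_image.2 ⟨v, Finset.mem_univ _, hv⟩, by omega⟩

end Circuit

/-! ### The set system of `hardFamily` -/

section

variable {n n' : ℕ} {f : MvPolynomial (Fin n) ℝ}

theorem MonotonePoly.rename (hf : MonotonePoly f) {ψ : Fin n → Fin n'}
    (hψ : Function.Injective ψ) : MonotonePoly (rename ψ f) := by
  intro d
  by_cases h : ∃ u : Fin n →₀ ℕ, u.mapDomain ψ = d
  · obtain ⟨u, rfl⟩ := h
    rw [coeff_rename_mapDomain _ hψ]
    exact hf u
  · rw [coeff_rename_eq_zero _ _ _ fun u hu => (h ⟨u, hu⟩).elim]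

theorem supp_rename {ψ : Fin n → Fin n'} (hψ : Function.Injective ψ) :
    supp (rename ψ f) = (ψ '' ·) '' supp f := by
  classical
  have key : ∀ u : Fin n →₀ ℕ, (((u.mapDomain ψ).support : Finset (Fin n')) : Set (Fin n')) =
      ψ '' (u.support : Set (Fin n)) := fun u => by
    rw [Finsupp.mapDomain_support_of_injective hψ, Finset.coe_image]
  ext m
  constructor
  · rintro ⟨d, hd, rfl⟩
    obtain ⟨u, rfl, hu⟩ := coeff_rename_ne_zero _ _ _ hd
    exact ⟨_, ⟨u, hu, rfl⟩, (key u).symm⟩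
  · rintro ⟨_, ⟨u, hu, rfl⟩, rfl⟩
    exact ⟨u.mapDomain ψ, by rwa [coeff_rename_mapDomain _ hψ], key u⟩

end

theorem mem_listJoins_ofFn {σ : Type} {l : ℕ} (A : Fin l → Set (Set σ)) (m : Set σ) :
    m ∈ listJoins (List.ofFn A) ↔ ∃ c : Fin l → Set σ, (∀ j, c j ∈ A j) ∧ m = ⋃ j, c j := by
  induction l generalizing m with
  | zero => simp [listJoins]
  | succ l ih =>
    rw [List.ofFn_succ]
    change m ∈ joins (A 0) (listJoins (List.ofFn fun i : Fin l => A i.succ)) ↔ _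
    constructor
    · rintro ⟨p, hp, q, hq, rfl⟩
      obtain ⟨c, hc, rfl⟩ := (ih _ _).1 hq
      refine ⟨Fin.cons p c, fun j => ?_, ?_⟩
      · refine Fin.cases ?_ (fun j => ?_) j
        exacts [hp, hc j]
      · ext x
        simp
    · rintro ⟨c, hc, rfl⟩
      refine ⟨c 0, hc 0, ⋃ j : Fin l, c j.succ, (ih _ _).2 ⟨_, fun j => hc j.succ, rfl⟩, ?_⟩
      ext x
      simp [Fin.exists_fin_succ]

/-- The position of a variable of `P^l_k`. -/
def Idx.position {l : ℕ} : ∀ {k : ℕ}, Idx l k → Fin (l ^ (2 * k))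
  | 0, _ => ⟨0, by simp⟩
  | k + 1, x => ⟨(x.1 : ℕ) * l ^ (2 * k + 1) + (x.2.1 : ℕ) * l ^ (2 * k) +
      (Idx.position (k := k) x.2.2 : ℕ), index_lt l k x.1 x.2.1 _⟩

/-- The position of a variable of a copy of `P^l_k` in `P^l_{k+1}`. -/
def copyPosition {l k : ℕ} (i j : Fin l) (a : Fin (l ^ (2 * k))) : Fin (l ^ (2 * (k + 1))) :=
  ⟨(i : ℕ) * l ^ (2 * k + 1) + (j : ℕ) * l ^ (2 * k) + (a : ℕ), index_lt l k i j a⟩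

theorem hardPoly_succ (l k : ℕ) : hardPoly l (k + 1) =
    ∑ i : Fin l, ∏ j : Fin l, rename (copyPosition i j) (hardPoly l k) := rfl

theorem copyPosition_injective {l k : ℕ} (i j : Fin l) :
    Function.Injective (copyPosition i j : Fin (l ^ (2 * k)) → _) := by
  intro a b h
  have := congrArg Fin.val h
  simp only [copyPosition] at this
  exact Fin.ext (by omega)

theorem Idx.position_injective {l : ℕ} : ∀ {k : ℕ},
    Function.Injective (Idx.position : Idx l k → Fin (l ^ (2 * k)))
  | 0 => fun _ _ _ => rfl
  | k + 1 => by
    intro (x : Fin l × Fin l × Idx l k) (y : Fin l × Fin l × Idx l k) h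
    obtain ⟨i, j, x⟩ := x
    obtain ⟨i', j', y⟩ := y
    have h := congrArg Fin.val h
    change (i : ℕ) * l ^ (2 * k + 1) + (j : ℕ) * l ^ (2 * k) + (x.position : ℕ) =
      (i' : ℕ) * l ^ (2 * k + 1) + (j' : ℕ) * l ^ (2 * k) + (y.position : ℕ) at h
    set N := l ^ (2 * k) with hN
    have e1 : l ^ (2 * k + 1) = l * N := by rw [hN]; ring
    have hx : (x.position : ℕ) < N := x.position.2
    have hy : (y.position : ℕ) < N := y.position.2
    have e : ∀ (i j : Fin l) (a : ℕ), (i : ℕ) * (l * N) + (j : ℕ) * N + a =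
        a + N * ((j : ℕ) + l * (i : ℕ)) := fun i j a => by ring
    rw [e1, e, e] at h
    have hmod := congrArg (· % N) h
    have hdiv := congrArg (· / N) h
    simp only [Nat.add_mul_mod_self_left, Nat.mod_eq_of_lt hx, Nat.mod_eq_of_lt hy] at hmod
    simp only [Nat.add_mul_div_left _ _ (Nat.zero_lt_of_lt hx), Nat.div_eq_of_lt hx,
      Nat.div_eq_of_lt hy, zero_add] at hdiv
    have hmod' := congrArg (· % l) hdiv
    have hdiv' := congrArg (· / l) hdiv
    simp only [Nat.add_mul_mod_self_left, Nat.mod_eq_of_lt j.2, Nat.mod_eq_of_lt j'.2] at hmod'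
    simp only [Nat.add_mul_div_left _ _ (Nat.zero_lt_of_lt j.2), Nat.div_eq_of_lt j.2,
      Nat.div_eq_of_lt j'.2, zero_add] at hdiv'
    obtain rfl := Idx.position_injective (Fin.ext hmod)
    obtain rfl : j = j' := Fin.ext hmod'
    obtain rfl : i = i' := Fin.ext hdiv'
    rfl

theorem Choice.image_vars_succ {l k : ℕ} (i : Fin l) (c : Fin l → Choice l k) :
    Idx.position '' Choice.vars (k := k + 1) (i, c) =
      ⋃ j, copyPosition i j '' (Idx.position '' (c j).vars) := by
  ext a
  simp only [Set.mem_iUnion]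
  constructor
  · rintro ⟨⟨i', j, x⟩, ⟨hi, hx⟩, rfl⟩
    obtain rfl : i' = i := hi
    exact ⟨j, _, ⟨x, hx, rfl⟩, rfl⟩
  · rintro ⟨j, _, ⟨x, hx, rfl⟩, rfl⟩
    exact ⟨Idx.copy i j x, ⟨rfl, hx⟩, rfl⟩

/-- Expanding the products, a monomial of `P^l_{k+1}` is a block `i` together with one monomial for
each of its `l` copies, which is exactly a `Choice`. Nonnegativity is carried along because
`supp_sum` and `supp_prod` need it. -/
theorem monotonePoly_hardPoly_and_supp (l k : ℕ) : MonotonePoly (hardPoly l k) ∧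
    supp (hardPoly l k) = (Idx.position '' ·) '' monos l k := by
  induction k with
  | zero =>
    refine ⟨monotonePoly_X _, ?_⟩
    rw [hardPoly, supp_X]
    have h : ∀ ω : Choice l 0, Idx.position '' ω.vars = {(⟨0, by simp⟩ : Fin (l ^ (2 * 0)))} := by
      intro ω
      ext a
      constructor
      · rintro ⟨x, -, rfl⟩
        rfl
      · rintro rfl
        exact ⟨(), trivial, rfl⟩
    ext m
    constructor
    · rintro rfl
      exact ⟨_, ⟨(), rfl⟩, h ()⟩
    · rintro ⟨_, ⟨ω, rfl⟩, rfl⟩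
      exact h ω
  | succ k ih =>
    obtain ⟨ihm, ihs⟩ := ih
    have hm1 : ∀ i j : Fin l, MonotonePoly (rename (copyPosition i j) (hardPoly l k)) :=
      fun i j => ihm.rename (copyPosition_injective i j)
    have e1 : ∀ i : Fin l, ∏ j : Fin l, rename (copyPosition i j) (hardPoly l k) =
        (List.ofFn fun j : Fin l => rename (copyPosition i j) (hardPoly l k)).prod := fun i => by
      rw [List.prod_ofFn]
    have hL1 : ∀ i, ∀ f ∈ (List.ofFn fun j : Fin l => rename (copyPosition i j) (hardPoly l k)),
        MonotonePoly f := by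
      intro i f hf
      obtain ⟨j, rfl⟩ := (List.mem_ofFn' _ _).1 hf
      exact hm1 i j
    have hm2 : ∀ i : Fin l,
        MonotonePoly (∏ j : Fin l, rename (copyPosition i j) (hardPoly l k)) := fun i => by
      rw [e1]
      exact monotonePoly_prod _ (hL1 i)
    have e2 : hardPoly l (k + 1) = (List.ofFn fun i : Fin l =>
        ∏ j : Fin l, rename (copyPosition i j) (hardPoly l k)).sum := by
      rw [List.sum_ofFn, hardPoly_succ]
    have hL2 : ∀ f ∈ (List.ofFn fun i : Fin l =>
        ∏ j : Fin l, rename (copyPosition i j) (hardPoly l k)), MonotonePoly f := by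
      intro f hf
      obtain ⟨i, rfl⟩ := (List.mem_ofFn' _ _).1 hf
      exact hm2 i
    rw [e2]
    refine ⟨monotonePoly_sum _ hL2, ?_⟩
    rw [supp_sum _ hL2]
    have hs : ∀ i m, m ∈ supp (∏ j : Fin l, rename (copyPosition i j) (hardPoly l k)) ↔
        ∃ c : Fin l → Choice l k, m = Idx.position '' Choice.vars (k := k + 1) (i, c) := by
      intro i m
      rw [e1, supp_prod _ (hL1 i), List.map_ofFn, mem_listJoins_ofFn]
      simp only [Function.comp, supp_rename (copyPosition_injective _ _), ihs,
        Choice.image_vars_succ]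
      constructor
      · rintro ⟨c, hc, rfl⟩
        have hc' : ∀ j, ∃ ω : Choice l k,
            copyPosition i j '' (Idx.position '' ω.vars) = c j := by
          intro j
          obtain ⟨_, ⟨_, ⟨ω, rfl⟩, rfl⟩, h⟩ := hc j
          exact ⟨ω, h⟩
        choose ω hω using hc'
        exact ⟨ω, by simp only [hω]⟩
      · rintro ⟨ω, rfl⟩
        exact ⟨_, fun j => ⟨_, ⟨_, ⟨ω j, rfl⟩, rfl⟩, rfl⟩, rfl⟩
    ext m
    constructor
    · rintro ⟨A, hA, hmA⟩
      obtain ⟨f, hf, rfl⟩ := List.mem_map.1 hA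
      obtain ⟨i, rfl⟩ := (List.mem_ofFn' _ _).1 hf
      obtain ⟨c, rfl⟩ := (hs i m).1 hmA
      exact ⟨_, ⟨(i, c), rfl⟩, rfl⟩
    · rintro ⟨_, ⟨ω, rfl⟩, rfl⟩
      exact ⟨_, List.mem_map_of_mem ((List.mem_ofFn' _ _).2 ⟨ω.1, rfl⟩),
        (hs ω.1 _).2 ⟨ω.2, rfl⟩⟩

/-- The variable of `hardFamily k n` with a given index. -/
noncomputable def familyPosition (k : ℕ) (n : ℕ+) (x : Idx (floorRoot k n) k) : Fin n :=
  Fin.castLE (floorRoot_pow_le k n) x.position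

theorem familyPosition_injective (k : ℕ) (n : ℕ+) : Function.Injective (familyPosition k n) :=
  (Fin.castLE_injective _).comp Idx.position_injective

/-- This transports the lower bounds from the abstract indices to polynomials in `n` variables, of
which only the first `l ^ (2 * k)` are used. -/
theorem restrict_supp_hardFamily (k : ℕ) (n : ℕ+) :
    restrict (familyPosition k n) (supp (hardFamily k n)) = monos (floorRoot k n) k := by
  rw [hardFamily, supp_rename (Fin.castLE_injective _), (monotonePoly_hardPoly_and_supp _ _).2,
    Set.image_image, restrict, Set.image_image]
  have : ∀ m : Set (Idx (floorRoot k n) k), familyPosition k n ⁻¹'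
      (Fin.castLE (floorRoot_pow_le k n) '' (Idx.position '' m)) = m := by
    intro m
    rw [Set.image_image]
    exact Set.preimage_image_eq m (familyPosition_injective k n)
  simp [this]

/-! ### Lower bounds for the classes -/

theorem dense_monos {l : ℕ} (hl : 0 < l) (k : ℕ) : Dense (monos l k) := by
  classical
  have h : (Finset.univ.filter fun ω : Choice l k => ω.vars ∈ monos l k) = Finset.univ :=
    Finset.filter_true_of_mem fun ω _ => ⟨ω, rfl⟩
  rw [Dense, h, Finset.card_univ]
  have := Choice.card_pos hl k
  omega

theorem floorRoot_pow {k : ℕ} (hk : 0 < k) (l : ℕ) : floorRoot k (l ^ (2 * k)) = l := by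
  have h := Real.pow_rpow_inv_natCast (x := (l : ℝ)) (n := 2 * k) (Nat.cast_nonneg _) (by omega)
  have h' : ((l ^ (2 * k) : ℕ) : ℝ) ^ (1 / (2 * (k : ℝ))) = l := by
    simpa [one_div] using h
  rw [floorRoot, h', Nat.floor_natCast]

/-- Taking `n = l ^ (2 * k)` makes the root exactly `l`, so the size bound is polynomial in `l` and
loses to `2 ^ l`. -/
theorem exists_large {k : ℕ} (hk : 0 < k) (c : ℕ) : ∃ n : ℕ+, 3 ≤ floorRoot k n ∧
    4 * k ≤ floorRoot k n ∧ 4 * (c * (n : ℕ) ^ c) < 2 ^ floorRoot k n := by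
  have h := isLittleO_pow_const_const_pow_of_one_lt (R := ℝ) (2 * k * c) (one_lt_two)
  -- The constant gives `(4 * c + 1) * n ^ c ≤ 2 ^ l`; the extra `1` makes the final inequality
  -- strict.
  have h1 := h.bound (c := 1 / (4 * c + 1)) (by positivity)
  obtain ⟨l, h1, h2⟩ := (h1.and (Filter.eventually_ge_atTop (4 * k + 3))).exists
  refine ⟨⟨l ^ (2 * k), pow_pos (by omega) _⟩, ?_⟩
  rw [PNat.mk_coe, floorRoot_pow hk]
  refine ⟨by omega, by omega, ?_⟩
  have h3 : (l : ℝ) ^ (2 * k * c) * (4 * c + 1) ≤ 2 ^ l := by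
    rw [Real.norm_of_nonneg (by positivity), Real.norm_of_nonneg (by positivity), one_div,
      inv_mul_eq_div, le_div_iff₀ (by positivity)] at h1
    exact h1
  have h4 : l ^ (2 * k * c) * (4 * c + 1) ≤ 2 ^ l := by exact_mod_cast h3
  have h5 : 0 < l ^ (2 * k * c) := pow_pos (by omega) _
  rw [← pow_mul]
  nlinarith

theorem hardFamily_notMem_widthClass {k : ℕ} (hk : 0 < k) : hardFamily k ∉ WidthClass k := by
  intro h
  simp only [WidthClass, Set.mem_iUnion] at h
  obtain ⟨c, -, h⟩ := h
  obtain ⟨n, h3, h4, hs⟩ := exists_large hk c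
  obtain ⟨-, C, L, hm, h2, hw, hsize, hpoly⟩ := h n
  have hcomp := (hm.widthComp h2 L hw hsize).restrict (familyPosition_injective k n)
  rw [hpoly, restrict_supp_hardFamily] at hcomp
  obtain ⟨k, rfl⟩ : ∃ k', k = k' + 1 := ⟨k - 1, by omega⟩
  exact not_widthComp h3 h4 hs subset_rfl (dense_monos (by omega) _) hcomp

theorem hardFamily_notMem_depthClass {k : ℕ} (hk : 0 < k) : hardFamily k ∉ DepthClass k := by
  intro h
  simp only [DepthClass, Set.mem_iUnion] at h
  obtain ⟨c, -, h⟩ := h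
  obtain ⟨n, h3, -, hs⟩ := exists_large hk c
  obtain ⟨-, C, hm, -, hw, hsize, hpoly⟩ := h n
  have hcomp := (hm.depthComp hw hsize).restrict (familyPosition_injective k n)
  rw [hpoly, restrict_supp_hardFamily] at hcomp
  obtain ⟨k, rfl⟩ : ∃ k', k = k' + 1 := ⟨k - 1, by omega⟩
  exact not_depthComp h3 hs subset_rfl (dense_monos (by omega) _) hcomp

/-! ### Circuits with nodes in an arbitrary finite type -/

/-- The label of a node of a circuit with nodes in `κ`. -/
inductive Label (n : ℕ) (κ : Type) : Type
  | var (i : Fin n) : Label n κ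
  | const (c : ℝ) : Label n κ
  | add (ch : Multiset κ) : Label n κ
  | mul (ch : Multiset κ) : Label n κ

namespace Label

variable {n s : ℕ} {κ κ' : Type}

def children : Label n κ → Multiset κ
  | var _ => 0
  | const _ => 0
  | add ch => ch
  | mul ch => ch

def IsGate : Label n κ → Prop
  | var _ => False
  | const _ => False
  | add _ => True
  | mul _ => True

def map (f : κ → κ') : Label n κ → Label n κ'
  | var i => var i
  | const c => const c
  | add ch => add (ch.map f)
  | mul ch => mul (ch.map f)

def toNode (e : κ → Fin s) : Label n κ → Node n s
  | var i => .var i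
  | const c => .const c
  | add ch => .add (ch.map e)
  | mul ch => .mul (ch.map e)

noncomputable def eval (val : κ → MvPolynomial (Fin n) ℝ) : Label n κ → MvPolynomial (Fin n) ℝ
  | var i => X i
  | const c => C c
  | add ch => (ch.map val).sum
  | mul ch => (ch.map val).prod

def Nonneg : Label n κ → Prop
  | var _ => True
  | const c => 0 ≤ c
  | add _ => True
  | mul _ => True

theorem children_map (f : κ → κ') (L : Label n κ) : (L.map f).children = L.children.map f := by
  cases L <;> simp [map, children]

theorem isGate_map (f : κ → κ') (L : Label n κ) : (L.map f).IsGate ↔ L.IsGate := by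
  cases L <;> simp [map, IsGate]

theorem nonneg_map (f : κ → κ') (L : Label n κ) : (L.map f).Nonneg ↔ L.Nonneg := by
  cases L <;> simp [map, Nonneg]

theorem eval_map (f : κ → κ') (val : κ' → MvPolynomial (Fin n) ℝ) (L : Label n κ) :
    (L.map f).eval val = L.eval (val ∘ f) := by
  cases L <;> simp [map, eval]

theorem children_toNode (e : κ → Fin s) (L : Label n κ) :
    (L.toNode e).children = L.children.map e := by
  cases L <;> simp [toNode, children, Node.children]

theorem isLeaf_toNode (e : κ → Fin s) (L : Label n κ) : (L.toNode e).IsLeaf ↔ ¬ L.IsGate := by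
  cases L <;> simp [toNode, IsGate, Node.IsLeaf]

end Label

/-- A monotone circuit with nodes in `κ`, the rank of the nodes, and the polynomials computed. -/
structure Diagram (n : ℕ) (κ : Type) where
  label : κ → Label n κ
  rank : κ → ℕ
  val : κ → MvPolynomial (Fin n) ℝ
  rank_lt : ∀ v, ∀ u ∈ (label v).children, rank u < rank v
  children_ne : ∀ v, (label v).IsGate → (label v).children ≠ 0
  nonneg : ∀ v, (label v).Nonneg
  val_eq : ∀ v, val v = (label v).eval val

/-- Nodes are sorted by rank, ties being broken by an arbitrary numbering; this is the topological
order required of a circuit. -/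
theorem exists_equiv_fin_of_rank {κ : Type} [Fintype κ] (rank : κ → ℕ) :
    ∃ e : κ ≃ Fin (Fintype.card κ), ∀ u v, rank u < rank v → e u < e v := by
  let f : κ → ℕ ×ₗ Fin (Fintype.card κ) := fun v => toLex (rank v, Fintype.equivFin κ v)
  have hf : Function.Injective f := fun u v h => by
    have := congrArg (fun p => (ofLex p).2) h
    exact (Fintype.equivFin κ).injective this
  let _ : LinearOrder κ := LinearOrder.lift' f hf
  let e := (Fintype.orderIsoFinOfCardEq κ rfl).symm
  refine ⟨e.toEquiv, fun u v h => ?_⟩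
  have : u < v := (Prod.Lex.toLex_lt_toLex.2 (Or.inl h) : f u < f v)
  exact e.lt_iff_lt.2 this

theorem Diagram.exists_circuit {n : ℕ} {κ : Type} [Fintype κ] (D : Diagram n κ) (out : κ) :
    ∃ (C : Circuit n) (e : κ ≃ Fin C.size), C.size = Fintype.card κ ∧ C.Monotone ∧
      (∀ v, C.node (e v) = (D.label v).toNode e) ∧ C.poly = D.val out ∧
      (∀ v, C.depthAt (e v) ≤ D.rank v) := by
  obtain ⟨e, he⟩ := exists_equiv_fin_of_rank D.rank
  let C : Circuit n :=
    { size := Fintype.card κ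
      node := fun v => (D.label (e.symm v)).toNode e
      child_lt := by
        intro v u hu
        rw [Label.children_toNode, Multiset.mem_map] at hu
        obtain ⟨w, hw, rfl⟩ := hu
        have := he _ _ (D.rank_lt _ w hw)
        rwa [e.apply_symm_apply] at this
      children_ne := by
        intro v hv
        rw [Label.isLeaf_toNode, not_not] at hv
        rw [Label.children_toNode, Ne, Multiset.map_eq_zero]
        exact D.children_ne _ hv
      output := e out }
  have hnode : ∀ v, C.node (e v) = (D.label v).toNode e := fun v => by
    change (D.label (e.symm (e v))).toNode e = _
    rw [e.symm_apply_apply]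
  have hpoly : ∀ r v, D.rank v = r → C.polyAt (e v) = D.val v := by
    intro r
    induction r using Nat.strong_induction_on with
    | _ r ih =>
      intro v hv
      have hch : ∀ u ∈ (D.label v).children, C.polyAt (e u) = D.val u := fun u hu =>
        ih _ (hv ▸ D.rank_lt v u hu) u rfl
      have hn := hnode v
      rw [D.val_eq]
      cases hl : D.label v with
      | var i =>
        rw [hl] at hn
        exact C.polyAt_var hn
      | const c =>
        rw [hl] at hn
        exact C.polyAt_const hn
      | add ch =>
        rw [hl] at hn hch
        rw [C.polyAt_add hn, Multiset.map_map]
        exact congrArg Multiset.sum (Multiset.map_congr rfl hch)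
      | mul ch =>
        rw [hl] at hn hch
        rw [C.polyAt_mul hn, Multiset.map_map]
        exact congrArg Multiset.prod (Multiset.map_congr rfl hch)
  have hdepth : ∀ r v, D.rank v = r → C.depthAt (e v) ≤ r := by
    intro r
    induction r using Nat.strong_induction_on with
    | _ r ih =>
      intro v hv
      by_cases hl : (C.node (e v)).IsLeaf
      · rw [C.depthAt_leaf hl]
        exact Nat.zero_le _
      · have hg := hl
        rw [hnode, Label.isLeaf_toNode, not_not] at hg
        -- A gate has a child of smaller rank, so `r` is positive and `1 + (r - 1) = r`.
        obtain ⟨w, hw⟩ := Multiset.exists_mem_of_ne_zero (D.children_ne v hg)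
        have hwr := D.rank_lt v w hw
        have : ((C.node (e v)).children.map C.depthAt).sup ≤ r - 1 := by
          rw [Multiset.sup_le]
          intro d hd
          rw [hnode, Label.children_toNode, Multiset.map_map, Multiset.mem_map] at hd
          obtain ⟨u, hu, rfl⟩ := hd
          have h1 := D.rank_lt v u hu
          have := ih _ (hv ▸ h1) u rfl
          simp only [Function.comp]
          omega
        rw [C.depthAt_gate hl]
        omega
  refine ⟨C, e, rfl, ?_, hnode, hpoly _ out rfl, fun v => hdepth _ v rfl⟩
  intro v c hv
  obtain ⟨v, rfl⟩ := e.surjective v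
  rw [hnode] at hv
  have := D.nonneg v
  cases hl : D.label v <;> simp_all [Label.toNode, Label.Nonneg]

/-! ### Circuits of small depth -/

/-- `f` is computed by a diagram without parallel wires of depth at most `d` and size at most
`s`. -/
def HasFormula {n : ℕ} (d s : ℕ) (f : MvPolynomial (Fin n) ℝ) : Prop :=
  ∃ (κ : Type) (_ : Fintype κ) (D : Diagram n κ) (out : κ), Fintype.card κ ≤ s ∧
    (∀ v, (D.label v).children.Nodup) ∧ (∀ v, D.rank v ≤ d) ∧ D.val out = f

theorem hasFormula_X {n : ℕ} (i : Fin n) : HasFormula 0 1 (X i : MvPolynomial (Fin n) ℝ) :=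
  ⟨Unit, inferInstance,
    { label := fun _ => .var i
      rank := fun _ => 0
      val := fun _ => X i
      rank_lt := fun v u hu => by simp [Label.children] at hu
      children_ne := fun v hv => hv.elim
      nonneg := fun _ => trivial
      val_eq := fun _ => rfl }, (), by simp, fun _ => by simp [Label.children], fun _ => le_rfl, rfl⟩

/-- The `l` diagrams are placed side by side under a new root `none`. Keeping them disjoint makes
the wires into the root distinct even if some of the `f i` coincide. -/
theorem HasFormula.node {n d s l : ℕ} (hl : 0 < l) {f : Fin l → MvPolynomial (Fin n) ℝ}
    (hf : ∀ i, HasFormula d s (f i)) (R : Label n (Fin l)) (hR : R.Nonneg)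
    (hch : R.children = (Finset.univ : Finset (Fin l)).val) :
    HasFormula (d + 1) (1 + l * s) (R.eval f) := by
  choose κ hκ D out hs hnd hd hval using hf
  let label : Option (Σ i, κ i) → Label n (Option (Σ i, κ i))
    | none => R.map fun i => some ⟨i, out i⟩
    | some p => ((D p.1).label p.2).map fun v => some ⟨p.1, v⟩
  let rank : Option (Σ i, κ i) → ℕ
    | none => d + 1
    | some p => (D p.1).rank p.2
  let val : Option (Σ i, κ i) → MvPolynomial (Fin n) ℝ
    | none => R.eval f
    | some p => (D p.1).val p.2
  refine ⟨Option (Σ i, κ i), inferInstance,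
    { label := label
      rank := rank
      val := val
      rank_lt := ?_
      children_ne := ?_
      nonneg := ?_
      val_eq := ?_ }, none, ?_, ?_, ?_, rfl⟩
  · rintro (_ | ⟨i, v⟩) u hu
    · rw [Label.children_map, Multiset.mem_map] at hu
      obtain ⟨i, -, rfl⟩ := hu
      exact Nat.lt_succ_of_le (hd i _)
    · rw [Label.children_map, Multiset.mem_map] at hu
      obtain ⟨w, hw, rfl⟩ := hu
      exact (D i).rank_lt v w hw
  · rintro (_ | ⟨i, v⟩) hv
    · rw [Label.children_map, Ne, Multiset.map_eq_zero, hch, Finset.val_eq_zero]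
      exact (Finset.univ_nonempty_iff.2 ⟨⟨0, hl⟩⟩).ne_empty
    · rw [Label.children_map, Ne, Multiset.map_eq_zero]
      exact (D i).children_ne v ((Label.isGate_map _ _).1 hv)
  · rintro (_ | ⟨i, v⟩)
    · exact (Label.nonneg_map _ _).2 hR
    · exact (Label.nonneg_map _ _).2 ((D i).nonneg v)
  · rintro (_ | ⟨i, v⟩)
    · refine Eq.trans ?_ (Label.eval_map _ _ _).symm
      change R.eval f = R.eval fun i => (D i).val (out i)
      simp only [hval]
    · exact ((D i).val_eq v).trans
        (Label.eval_map (fun v => some (⟨i, v⟩ : Σ i, κ i)) val ((D i).label v)).symm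
  · rw [Fintype.card_option, Fintype.card_sigma, add_comm]
    refine Nat.add_le_add_left ((Finset.sum_le_card_nsmul _ _ s fun i _ => hs i).trans ?_) 1
    simp
  · rintro (_ | ⟨i, v⟩)
    · rw [Label.children_map, hch]
      refine Multiset.Nodup.map (fun i j h => ?_) (Finset.nodup _)
      simpa using congrArg (Option.map Sigma.fst) h
    · rw [Label.children_map]
      refine Multiset.Nodup.map (fun u w h => ?_) (hnd i v)
      simpa using h
  · rintro (_ | ⟨i, v⟩)
    · exact le_rfl
    · exact (hd i v).trans (Nat.le_succ d)

theorem HasFormula.sum {n d s l : ℕ} (hl : 0 < l) {f : Fin l → MvPolynomial (Fin n) ℝ}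
    (hf : ∀ i, HasFormula d s (f i)) : HasFormula (d + 1) (1 + l * s) (∑ i, f i) :=
  HasFormula.node hl hf (.add Finset.univ.val) trivial rfl

theorem HasFormula.prod {n d s l : ℕ} (hl : 0 < l) {f : Fin l → MvPolynomial (Fin n) ℝ}
    (hf : ∀ i, HasFormula d s (f i)) : HasFormula (d + 1) (1 + l * s) (∏ i, f i) :=
  HasFormula.node hl hf (.mul Finset.univ.val) trivial rfl

theorem HasFormula.mono {n d s s' : ℕ} {f : MvPolynomial (Fin n) ℝ} (h : HasFormula d s f)
    (hs : s ≤ s') : HasFormula d s' f := by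
  obtain ⟨κ, hκ, D, out, h1, h2⟩ := h
  exact ⟨κ, hκ, D, out, h1.trans hs, h2⟩

theorem rename_hardPoly_succ {l k n : ℕ} (ψ : Fin (l ^ (2 * (k + 1))) → Fin n) :
    rename ψ (hardPoly l (k + 1)) =
      ∑ i : Fin l, ∏ j : Fin l, rename (ψ ∘ copyPosition i j) (hardPoly l k) := by
  simp only [hardPoly_succ, map_sum, map_prod, rename_rename]

theorem hasFormula_hardPoly {l : ℕ} (hl : 0 < l) (k : ℕ) {n : ℕ} (ψ : Fin (l ^ (2 * k)) → Fin n) :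
    HasFormula (2 * k) ((2 * k + 1) * l ^ (2 * k)) (rename ψ (hardPoly l k)) := by
  induction k with
  | zero =>
    rw [hardPoly, rename_X]
    simpa using hasFormula_X _
  | succ k ih =>
    rw [rename_hardPoly_succ]
    refine (HasFormula.sum hl fun i => HasFormula.prod hl fun j => ih _).mono ?_
    have e : l ^ (2 * (k + 1)) = l * l * l ^ (2 * k) := by ring
    have h1 : 1 ≤ l ^ (2 * k) := Nat.one_le_pow _ _ hl
    have h2 : l ≤ l * l := Nat.le_mul_of_pos_left l hl
    rw [e]
    nlinarith [Nat.mul_le_mul_left (l * l) h1]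

theorem floorRoot_pos (k : ℕ) (n : ℕ+) : 0 < floorRoot k n := by
  refine Nat.floor_pos.2 (Real.one_le_rpow ?_ (by positivity))
  exact_mod_cast n.2

theorem mul_le_mul_pow {c : ℕ} (hc : 0 < c) (n : ℕ+) : c * (n : ℕ) ≤ c * (n : ℕ) ^ c :=
  Nat.mul_le_mul_left _ (Nat.le_self_pow hc.ne' _)

theorem hardFamily_mem_depthClass (k : ℕ) : hardFamily k ∈ DepthClass (2 * k) := by
  simp only [DepthClass, Set.mem_iUnion]
  -- The formula has at most `(2 * k + 1) * l ^ (2 * k)` nodes, and `l ^ (2 * k) ≤ n`.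
  refine ⟨2 * k + 1, by omega, fun n => ?_⟩
  obtain ⟨κ, hκ, D, out, hs, hnd, hd, hval⟩ :=
    hasFormula_hardPoly (floorRoot_pos k n) k (Fin.castLE (floorRoot_pow_le k n))
  obtain ⟨C, e, hsize, hm, hnode, hpoly, hdepth⟩ := D.exists_circuit out
  have hC : C.poly = hardFamily k n := hpoly.trans hval
  refine ⟨hC ▸ hm.monotonePoly _, C, hm, fun v => ?_, Finset.sup_le fun v _ => ?_, ?_, hC⟩
  · obtain ⟨v, rfl⟩ := e.surjective v
    rw [hnode, Label.children_toNode]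
    exact (hnd v).map e.injective
  · obtain ⟨v, rfl⟩ := e.surjective v
    exact (hdepth v).trans (hd v)
  · rw [hsize]
    exact (hs.trans (Nat.mul_le_mul_left _ (floorRoot_pow_le k n))).trans
      (mul_le_mul_pow (by omega) n)

/-! ### Circuits of small width -/

/-- The leaves of a program: the variables and the scalars `0` and `1`. -/
abbrev ProgramLeaf (n : ℕ) : Type := Fin n ⊕ Bool

def ProgramLeaf.label {n : ℕ} {κ : Type} : ProgramLeaf n → Label n κ
  | .inl i => .var i
  | .inr b => .const (if b then 1 else 0)

noncomputable def ProgramLeaf.poly {n : ℕ} : ProgramLeaf n → MvPolynomial (Fin n) ℝ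
  | .inl i => X i
  | .inr b => C (if b then 1 else 0)

/-- The contents of `w` registers. -/
abbrev Registers (n w : ℕ) : Type := Fin w → MvPolynomial (Fin n) ℝ

noncomputable def Registers.value {n w : ℕ} (st : Registers n w) (x : ProgramLeaf n ⊕ Fin w) :
    MvPolynomial (Fin n) ℝ := x.elim ProgramLeaf.poly st

/-- A register is computed by one gate from the leaves and the registers `st`. -/
def Registers.Computes {n w : ℕ} (st : Registers n w) (f : MvPolynomial (Fin n) ℝ) : Prop :=
  ∃ x y, f = st.value x + st.value y ∨ f = st.value x * st.value y

/-- All registers are updated by one gate each. -/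
def Registers.Step {n w : ℕ} (st st' : Registers n w) : Prop := ∀ r, st.Computes (st' r)

/-- The registers `st'` can be computed from `st` in a number of steps. -/
def Registers.Reach {n w : ℕ} (t : ℕ) (st st' : Registers n w) : Prop :=
  ∃ S : ℕ → Registers n w, S 0 = st ∧ S t = st' ∧ ∀ i < t, (S i).Step (S (i + 1))

namespace Registers

variable {n w : ℕ}

theorem Reach.refl (st : Registers n w) : Reach 0 st st := ⟨fun _ => st, rfl, rfl, by simp⟩

theorem Reach.of_step {st st' : Registers n w} (h : st.Step st') : Reach 1 st st' := by
  refine ⟨fun i => if i = 0 then st else st', by simp, by simp, fun i hi => ?_⟩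
  obtain rfl : i = 0 := by omega
  simpa using h

theorem Reach.trans {t t' : ℕ} {st st' st'' : Registers n w} (h : Reach t st st')
    (h' : Reach t' st' st'') : Reach (t + t') st st'' := by
  obtain ⟨S, h0, ht, hS⟩ := h
  obtain ⟨S', h0', ht', hS'⟩ := h'
  refine ⟨fun i => if i ≤ t then S i else S' (i - t), by simpa using h0, ?_, fun i hi => ?_⟩
  · by_cases h : t' = 0
    · subst h
      simp [ht, ← ht', h0']
    · simp [h, ht']
  · by_cases h1 : i + 1 ≤ t
    · have := hS i (by omega)
      simpa [h1, show i ≤ t by omega] using this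
    · by_cases h2 : i = t
      · subst h2
        have := hS' 0 (by omega)
        simpa [ht, h0'] using this
      · have := hS' (i - t) (by omega)
        simpa [h1, show ¬ i ≤ t by omega, show i - t + 1 = i + 1 - t by omega] using this

/-- A register is kept through a step by adding the scalar `0`. -/
theorem Computes.self (st : Registers n w) (r : Fin w) : st.Computes (st r) :=
  ⟨.inr r, .inl (.inr false), Or.inl (by simp [value, ProgramLeaf.poly])⟩

theorem Reach.update {st : Registers n w} {f : MvPolynomial (Fin n) ℝ} (hf : st.Computes f)
    (r : Fin w) : Reach 1 st (Function.update st r f) := by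
  refine Reach.of_step fun r' => ?_
  by_cases h : r' = r
  · subst h
    simpa using hf
  · rw [Function.update_of_ne h]
    exact Computes.self st r'

theorem computes_const (st : Registers n w) (b : Bool) :
    st.Computes (if b then 1 else 0) := by
  refine ⟨.inl (.inr b), .inl (.inr false), Or.inl ?_⟩
  cases b <;> simp [value, ProgramLeaf.poly]

/-- A product accumulated in the register `a`. -/
theorem Reach.list_prod {ι : Type} {f : ι → MvPolynomial (Fin n) ℝ} {t : ℕ} {U : Set (Fin w)}
    {a : Fin w} (ha : a ∉ U)
    (hf : ∀ i (st : Registers n w), ∃ st', Reach t st st' ∧ (∀ r ∉ U, st' r = st r) ∧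
      ∃ x, st'.value x = f i) (L : List ι) (st : Registers n w) :
    ∃ st', Reach (L.length * (t + 1)) st st' ∧ (∀ r ∉ U, r ≠ a → st' r = st r) ∧
      st' a = st a * (L.map f).prod := by
  induction L generalizing st with
  | nil => exact ⟨st, by simpa using Reach.refl st, fun _ _ _ => rfl, by simp⟩
  | cons i L ih =>
    obtain ⟨st₁, h₁, hU, x, hx⟩ := hf i st
    have hc : st₁.Computes (st a * f i) :=
      ⟨.inr a, x, Or.inr (by rw [hx, ← hU a ha]; rfl)⟩
    obtain ⟨st₂, h₂, hU₂, ha₂⟩ := ih (Function.update st₁ a (st a * f i))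
    refine ⟨st₂, ?_, fun r hr hra => ?_, ?_⟩
    · have := (h₁.trans (Reach.update hc a)).trans h₂
      rwa [List.length_cons, Nat.succ_mul, add_comm (L.length * (t + 1))]
    · rw [hU₂ r hr hra, Function.update_of_ne hra, hU r hr]
    · rw [ha₂, Function.update_self, List.map_cons, List.prod_cons, mul_assoc]

/-- A sum accumulated in the register `a`. -/
theorem Reach.list_sum {ι : Type} {f : ι → MvPolynomial (Fin n) ℝ} {t : ℕ} {U : Set (Fin w)}
    {a : Fin w} (ha : a ∉ U)
    (hf : ∀ i (st : Registers n w), ∃ st', Reach t st st' ∧ (∀ r ∉ U, st' r = st r) ∧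
      ∃ x, st'.value x = f i) (L : List ι) (st : Registers n w) :
    ∃ st', Reach (L.length * (t + 1)) st st' ∧ (∀ r ∉ U, r ≠ a → st' r = st r) ∧
      st' a = st a + (L.map f).sum := by
  induction L generalizing st with
  | nil => exact ⟨st, by simpa using Reach.refl st, fun _ _ _ => rfl, by simp⟩
  | cons i L ih =>
    obtain ⟨st₁, h₁, hU, x, hx⟩ := hf i st
    have hc : st₁.Computes (st a + f i) :=
      ⟨.inr a, x, Or.inl (by rw [hx, ← hU a ha]; rfl)⟩
    obtain ⟨st₂, h₂, hU₂, ha₂⟩ := ih (Function.update st₁ a (st a + f i))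
    refine ⟨st₂, ?_, fun r hr hra => ?_, ?_⟩
    · have := (h₁.trans (Reach.update hc a)).trans h₂
      rwa [List.length_cons, Nat.succ_mul, add_comm (L.length * (t + 1))]
    · rw [hU₂ r hr hra, Function.update_of_ne hra, hU r hr]
    · rw [ha₂, Function.update_self, List.map_cons, List.sum_cons, add_assoc]

end Registers

/-- The number of steps in which `P^l_k` is computed. -/
def programLength (l : ℕ) : ℕ → ℕ
  | 0 => 0
  | k + 1 => 1 + l * (1 + l * (programLength l k + 1) + 1)

theorem programLength_le {l : ℕ} (hl : 0 < l) (k : ℕ) :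
    programLength l k ≤ 4 * k * l ^ (2 * k) := by
  induction k with
  | zero => simp [programLength]
  | succ k ih =>
    have e : l ^ (2 * (k + 1)) = l * l * l ^ (2 * k) := by ring
    have h1 : 1 ≤ l ^ (2 * k) := Nat.one_le_pow _ _ hl
    have h2 : l ≤ l * l := Nat.le_mul_of_pos_left l hl
    rw [programLength, e]
    nlinarith [Nat.mul_le_mul_left (l * l) h1, Nat.mul_le_mul_left (l * l) ih]

/-- `P^l_k` is computed by a program which changes only the first `2 * k` registers. -/
theorem reach_hardPoly (l k : ℕ) {n w : ℕ} (hw : 2 * k ≤ w) (ψ : Fin (l ^ (2 * k)) → Fin n)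
    (st : Registers n w) : ∃ st', Registers.Reach (programLength l k) st st' ∧
      (∀ r ∉ {r : Fin w | (r : ℕ) < 2 * k}, st' r = st r) ∧
      ∃ x, st'.value x = rename ψ (hardPoly l k) := by
  induction k generalizing st with
  | zero =>
    refine ⟨st, Registers.Reach.refl st, fun _ _ => rfl, .inl (.inl (ψ ⟨0, by simp⟩)), ?_⟩
    rw [hardPoly, rename_X]
    rfl
  | succ k ih =>
    -- Each level adds two registers: `a` accumulates the inner product and `b` the outer sum. The
    -- recursive calls overwrite only the registers below both.
    let a : Fin w := ⟨2 * k, by omega⟩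
    let b : Fin w := ⟨2 * k + 1, by omega⟩
    have hab : b ≠ a := by simp [a, b]
    let U : Set (Fin w) := {r | (r : ℕ) < 2 * k}
    let V : Set (Fin w) := {r | (r : ℕ) < 2 * k + 1}
    have hV : ∀ r ∉ V, r ∉ U ∧ r ≠ a := by
      intro r hr
      have hr : ¬ (r : ℕ) < 2 * k + 1 := hr
      refine ⟨fun h : (r : ℕ) < 2 * k => by omega, ?_⟩
      rintro rfl
      exact hr (Nat.lt_succ_self _)
    have hprod : ∀ (i : Fin l) (st : Registers n w), ∃ st',
        Registers.Reach (1 + l * (programLength l k + 1)) st st' ∧ (∀ r ∉ V, st' r = st r) ∧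
        ∃ x, st'.value x = ∏ j : Fin l, rename (ψ ∘ copyPosition i j) (hardPoly l k) := by
      intro i st
      have h1 := Registers.Reach.update (st.computes_const true) a
      obtain ⟨st', h2, hU, ha⟩ := Registers.Reach.list_prod (a := a) (U := U)
        (fun h : 2 * k < 2 * k => lt_irrefl _ h)
        (fun j st => ih (by omega) (ψ ∘ copyPosition i j) st) (List.finRange l)
        (Function.update st a (if true then 1 else 0))
      rw [List.length_finRange] at h2
      refine ⟨st', h1.trans h2, fun r hr => ?_, .inr a, ?_⟩
      · rw [hU r (hV r hr).1 (hV r hr).2, Function.update_of_ne (hV r hr).2]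
      · change st' a = _
        rw [ha, Function.update_self, if_pos rfl, one_mul, Fin.prod_univ_def]
    have h1 := Registers.Reach.update (st.computes_const false) b
    obtain ⟨st', h2, hU, ha⟩ := Registers.Reach.list_sum (a := b) (U := V)
      (fun h : 2 * k + 1 < 2 * k + 1 => lt_irrefl _ h) hprod (List.finRange l)
      (Function.update st b (if false then 1 else 0))
    rw [List.length_finRange] at h2
    refine ⟨st', h1.trans h2, fun r hr => ?_, .inr b, ?_⟩
    · have hr : ¬ (r : ℕ) < 2 * (k + 1) := hr
      have hrb : r ≠ b := by
        rintro rfl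
        exact hr (Nat.lt_succ_self _)
      rw [hU r (fun h : (r : ℕ) < 2 * k + 1 => by omega) hrb, Function.update_of_ne hrb]
    · change st' b = _
      rw [ha, Function.update_self, rename_hardPoly_succ, Fin.sum_univ_def]
      simp

/-- The operand `x` of a gate in layer `t + 1`, as a node. -/
def operandNode {n w T : ℕ} (t : Fin (T + 1)) (x : ProgramLeaf n ⊕ Fin w) :
    ProgramLeaf n ⊕ Fin (T + 1) × Fin w := x.map id fun r => (t, r)

/-- A program gives a layered circuit. -/
theorem Registers.Reach.exists_circuit {n w T : ℕ} {st' : Registers n w}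
    (h : Registers.Reach T (fun _ => 0) st') (x : ProgramLeaf n ⊕ Fin w) :
    ∃ (C : Circuit n) (L : C.Layering), C.Monotone ∧ C.FanInTwo ∧ L.width ≤ w ∧
      C.size = n + 2 + (T + 1) * w ∧ C.poly = st'.value x := by
  obtain ⟨S, h0, hT, hS⟩ := h
  let κ := ProgramLeaf n ⊕ Fin (T + 1) × Fin w
  let rank : κ → ℕ := Sum.elim (fun _ => 0) fun p => (p.1 : ℕ) + 1
  let val : κ → MvPolynomial (Fin n) ℝ := Sum.elim ProgramLeaf.poly fun p => S p.1 p.2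
  let zero : κ := .inl (.inr false)
  have hval : ∀ (t : Fin (T + 1)) y, val (operandNode t y) = (S t).value y := by
    rintro t (y | y) <;> rfl
  have hlabel : ∀ p : Fin (T + 1) × Fin w, ∃ L : Label n κ, L.IsGate ∧ L.Nonneg ∧
      L.children.card = 2 ∧ (∀ u ∈ L.children, rank u = 0 ∨ rank u + 1 = (p.1 : ℕ) + 1) ∧
      S p.1 p.2 = L.eval val := by
    rintro ⟨⟨t, ht⟩, r⟩
    cases t with
    | zero =>
      -- The initial zero registers must be gates, since registers are placed above the first layer;
      -- each is `0 + 0`.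
      refine ⟨.add {zero, zero}, trivial, trivial, rfl, fun u hu => Or.inl ?_, ?_⟩
      · obtain rfl : u = zero := by simpa [Label.children] using hu
        rfl
      · simp [Label.eval, val, zero, ProgramLeaf.poly, h0]
    | succ t =>
      let t' : Fin (T + 1) := ⟨t, by omega⟩
      have hrank : ∀ y : ProgramLeaf n ⊕ Fin w, rank (operandNode t' y) = 0 ∨
          rank (operandNode t' y) + 1 = t + 1 + 1 := by
        rintro (y | y)
        exacts [Or.inl rfl, Or.inr rfl]
      obtain ⟨y, z, h | h⟩ := hS t (by omega) r
      · refine ⟨.add {operandNode t' y, operandNode t' z}, trivial, trivial, rfl,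
          fun u hu => ?_, ?_⟩
        · have hu : u = operandNode t' y ∨ u = operandNode t' z := by
            simpa [Label.children] using hu
          rcases hu with rfl | rfl
          exacts [hrank y, hrank z]
        · simp only [Label.eval, Multiset.insert_eq_cons, Multiset.map_cons,
            Multiset.map_singleton, Multiset.sum_cons, Multiset.sum_singleton, hval]
          exact h
      · refine ⟨.mul {operandNode t' y, operandNode t' z}, trivial, trivial, rfl,
          fun u hu => ?_, ?_⟩
        · have hu : u = operandNode t' y ∨ u = operandNode t' z := by
            simpa [Label.children] using hu
          rcases hu with rfl | rfl
          exacts [hrank y, hrank z]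
        · simp only [Label.eval, Multiset.insert_eq_cons, Multiset.map_cons,
            Multiset.map_singleton, Multiset.prod_cons, Multiset.prod_singleton, hval]
          exact h
  choose label hgate hnonneg hcard hch heval using hlabel
  have hleaf : ∀ y : ProgramLeaf n, (y.label : Label n κ).children = 0 ∧
      ¬ (y.label : Label n κ).IsGate ∧ (y.label : Label n κ).Nonneg ∧
      y.poly = (y.label : Label n κ).eval val := by
    rintro (i | b)
    · exact ⟨rfl, id, trivial, rfl⟩
    · refine ⟨rfl, id, ?_, rfl⟩
      cases b <;> simp [ProgramLeaf.label, Label.Nonneg]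
  let D : Diagram n κ :=
    { label := Sum.elim ProgramLeaf.label label
      rank := rank
      val := val
      rank_lt := by
        rintro (y | p) u hu
        · simp [(hleaf y).1] at hu
        · have h1 := hch p u hu
          have h2 : rank (.inr p) = (p.1 : ℕ) + 1 := rfl
          omega
      children_ne := by
        rintro (y | p) hv
        · exact ((hleaf y).2.1 hv).elim
        · intro h
          have h1 := hcard p
          simp only [Sum.elim_inr] at h
          simp [h] at h1
      nonneg := by
        rintro (y | p)
        exacts [(hleaf y).2.2.1, hnonneg p]
      val_eq := by
        rintro (y | p)
        exacts [(hleaf y).2.2.2, heval p] }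
  obtain ⟨C, e, hsize, hm, hnode, hpoly, -⟩ := D.exists_circuit (operandNode (Fin.last T) x)
  have hnodeLeaf : ∀ y : ProgramLeaf n, (C.node (e (.inl y))).IsLeaf := fun y => by
    rw [hnode, Label.isLeaf_toNode]
    exact (hleaf y).2.1
  let L : C.Layering :=
    -- Leaves, of rank `0`, form layer `1`; the registers after `t` steps form layer `t + 2`.
    { layer := fun v => rank (e.symm v) + 1
      one_le := fun v => by omega
      leaf_of_one := by
        intro v hv
        obtain ⟨y | p, rfl⟩ := e.surjective v
        · exact hnodeLeaf y
        · simp [rank] at hv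
      child := by
        intro v u hu
        obtain ⟨v, rfl⟩ := e.surjective v
        rw [hnode, Label.children_toNode, Multiset.mem_map] at hu
        obtain ⟨u, hu, rfl⟩ := hu
        simp only [Equiv.symm_apply_apply]
        rcases v with y | p
        · simp [D, (hleaf y).1] at hu
        · have h1 := hch p u hu
          have h2 : rank (.inr p) = (p.1 : ℕ) + 1 := rfl
          omega }
  refine ⟨C, L, hm, ?_, ?_, ?_, ?_⟩
  · intro v hv
    obtain ⟨y | p, rfl⟩ := e.surjective v
    · exact (hv (hnodeLeaf y)).elim
    · rw [hnode, Label.children_toNode, Multiset.card_map]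
      exact hcard p
  · refine Finset.sup_le fun t ht => ?_
    have ht1 : 1 < t := (Finset.mem_filter.1 ht).2
    -- A layer above the first injects into the `w` registers at time `t - 2`. The value `C.output`
    -- only makes the map total; it is not needed for nonempty layers.
    have hsub : (Finset.univ.filter fun v => L.layer v = t) ⊆ Finset.univ.image
        fun r : Fin w => if h : t - 2 < T + 1 then e (.inr (⟨t - 2, h⟩, r)) else C.output := by
      intro v hv
      have hv : rank (e.symm v) + 1 = t := (Finset.mem_filter.1 hv).2
      obtain ⟨y | ⟨i, r⟩, rfl⟩ := e.surjective v
      · rw [e.symm_apply_apply] at hv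
        simp only [rank, Sum.elim_inl] at hv
        omega
      · rw [e.symm_apply_apply] at hv
        simp only [rank, Sum.elim_inr] at hv
        obtain rfl : t = i + 2 := by omega
        exact Finset.mem_image.2 ⟨r, Finset.mem_univ _, dif_pos i.2⟩
    exact (Finset.card_le_card hsub).trans (Finset.card_image_le.trans (by simp))
  · rw [hsize]
    simp [κ]
  · rw [hpoly]
    change val _ = _
    rw [hval, Fin.val_last, hT]

theorem hardFamily_mem_widthClass (k : ℕ) : hardFamily k ∈ WidthClass (2 * k) := by
  simp only [WidthClass, Set.mem_iUnion]
  -- The circuit has `n + 2 + (T + 1) * (2 * k)` nodes with `T ≤ 4 * k * n`; bounding `1` by `n`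
  -- gives this multiple of `n`.
  refine ⟨8 * k * k + 2 * k + 3, by omega, fun n => ?_⟩
  obtain ⟨st', hreach, -, x, hx⟩ := reach_hardPoly (floorRoot k n) k (le_refl (2 * k))
    (Fin.castLE (floorRoot_pow_le k n)) fun _ => 0
  obtain ⟨C, L, hm, h2, hw, hsize, hpoly⟩ := hreach.exists_circuit x
  have hC : C.poly = hardFamily k n := hpoly.trans hx
  refine ⟨hC ▸ hm.monotonePoly _, C, L, hm, h2, hw, le_trans ?_ (mul_le_mul_pow (by omega) n), hC⟩
  have h1 : programLength (floorRoot k n) k ≤ 4 * k * n :=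
    (programLength_le (floorRoot_pos k n) k).trans
      (Nat.mul_le_mul_left _ (floorRoot_pow_le k n))
  have h3 : 1 ≤ (n : ℕ) := n.2
  rw [hsize]
  nlinarith [Nat.mul_le_mul_right (2 * k) h1, Nat.mul_le_mul_left (2 * k) h3]

/-! ### Inclusions between the classes and the main theorem -/

theorem WidthClass.mono {k k' : ℕ} (h : k ≤ k') : WidthClass k ⊆ WidthClass k' := by
  intro f hf
  simp only [WidthClass, Set.mem_iUnion] at hf ⊢
  obtain ⟨c, hc, hf⟩ := hf
  refine ⟨c, hc, fun n => ?_⟩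
  obtain ⟨h0, C, L, h1, h2, h3, h4⟩ := hf n
  exact ⟨h0, C, L, h1, h2, h3.trans h, h4⟩

theorem DepthClass.mono {k k' : ℕ} (h : k ≤ k') : DepthClass k ⊆ DepthClass k' := by
  intro f hf
  simp only [DepthClass, Set.mem_iUnion] at hf ⊢
  obtain ⟨c, hc, hf⟩ := hf
  refine ⟨c, hc, fun n => ?_⟩
  obtain ⟨h0, C, h1, h2, h3, h4⟩ := hf n
  exact ⟨h0, C, h1, h2, h3.trans h, h4⟩

end MonotoneCircuit

theorem mainTheorem2 (k : ℕ) (hk : 0 < k) :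
    MonotoneCircuit.WidthClass k ⊂ MonotoneCircuit.WidthClass (2 * k) ∧
    MonotoneCircuit.DepthClass k ⊂ MonotoneCircuit.DepthClass (2 * k) ∧
    MonotoneCircuit.hardFamily k ∈
      MonotoneCircuit.WidthClass (2 * k) \ MonotoneCircuit.WidthClass k ∧
    MonotoneCircuit.hardFamily k ∈
      MonotoneCircuit.DepthClass (2 * k) \ MonotoneCircuit.DepthClass k := by
  have hw := MonotoneCircuit.hardFamily_mem_widthClass k
  have hw' := MonotoneCircuit.hardFamily_notMem_widthClass hk
  have hd := MonotoneCircuit.hardFamily_mem_depthClass k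
  have hd' := MonotoneCircuit.hardFamily_notMem_depthClass hk
  exact ⟨⟨MonotoneCircuit.WidthClass.mono (by omega), fun h => hw' (h hw)⟩,
    ⟨MonotoneCircuit.DepthClass.mono (by omega), fun h => hd' (h hd)⟩, ⟨hw, hw'⟩, ⟨hd, hd'⟩⟩
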